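/- Let $P \subset \mathbb{R}^{d}$ be a closed convex cone that is spanning ($P - P = \mathbb{R}^{d}$) and pointed ($P \cap -P = \{0\}$), and let $K$ be a separable complex Hilbert space, with inner product linear in the second variable. An isometric representation of $P$ on $K$ is a map $V : P \to B(K)$ such that every $V_x$ is an isometry, $V_{x+y} = V_x V_y$ for all $x, y \in P$, and $x \mapsto V_x \xi$ is continuous for every $\xi \in K$. For a Hilbert space $H$, an $\mathrm{E}_0$-semigroup over $P$ on $B(H)$ is a family $\alpha = \{\alpha_x\}_{x \in P}$ of normal unital $*$-endomorphisms of $B(H)$ with $\alpha_x \circ \alpha_y = \alpha_{x+y}$ for $x, y \in P$, $\alpha_0 = \mathrm{Id}$, and such that $x \mapsto \rho(\alpha_x(T))$ is continuous on $P$ for every $T \in B(H)$ and every $\rho$ in the predual $B(H)_*$. Let $\Gamma(K) = \bigoplus_{n \ge 0} K^{\otimes_s n}$ be the symmetric Fock space, let $e(u) = \sum_{n \ge 0} u^{\otimes n}/\sqrt{n!}$ be the exponential vectors, and let $W(u)$, $u \in K$, be the Weyl operators, the unitary operators on $\Gamma(K)$ determined by $W(u) e(v) = e^{-\|u\|^{2}/2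 - \langle u | v \rangle}\, e(u + v)$ for $v \in K$. Then for every isometric representation $V$ of $P$ on $K$ there exists a unique $\mathrm{E}_0$-semigroup $\alpha^{V} = \{\alpha^{V}_x\}_{x \in P}$ over $P$ on $B(\Gamma(K))$ satisfying $$\alpha^{V}_x(W(u)) = W(V_x u) \qquad \text{for all } x \in P,\ u \in K.$$ It is called the CCR flow associated to $V$. -/

import Mathlib

noncomputable section

namespace CCR

open scoped InnerProductSpace Matrix ComplexOrder

variable (K : Type*) [NormedAddCommGroup K] [InnerProductSpace ℂ K]

/-- The algebraic `n`-fold tensor power of `K` over `ℂ`. It is a type of its own, so that it can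
carry the Hilbert space (semi)norm. -/
def AlgTensorPower (n : ℕ) : Type _ := PiTensorProduct ℂ (fun _ : Fin n => K)

instance (n : ℕ) : AddCommGroup (AlgTensorPower K n) :=
  inferInstanceAs (AddCommGroup (PiTensorProduct ℂ (fun _ : Fin n => K)))

instance (n : ℕ) : Module ℂ (AlgTensorPower K n) :=
  inferInstanceAs (Module ℂ (PiTensorProduct ℂ (fun _ : Fin n => K)))

variable {K}

/-- The elementary tensor `x₀ ⊗ ⋯ ⊗ xₙ₋₁`. -/
def algTprod (n : ℕ) : MultilinearMap ℂ (fun _ : Fin n => K) (AlgTensorPower K n) :=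
  PiTensorProduct.tprod ℂ

theorem algTprod_span (n : ℕ) :
    Submodule.span ℂ (Set.range (algTprod (K := K) n)) = ⊤ :=
  PiTensorProduct.span_tprod_eq_top

/-- The linear functional `y₀ ⊗ ⋯ ⊗ yₙ₋₁ ↦ ∏ᵢ ⟪xᵢ, yᵢ⟫`. -/
def pairLeft {n : ℕ} (x : Fin n → K) : AlgTensorPower K n →ₗ[ℂ] ℂ :=
  PiTensorProduct.lift
    ((MultilinearMap.mkPiRing ℂ (Fin n) (1 : ℂ)).compLinearMap
      (fun i => (innerSL ℂ (x i)).toLinearMap))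

theorem pairLeft_tprod {n : ℕ} (x y : Fin n → K) :
    pairLeft x (algTprod n y) = ∏ i, ⟪x i, y i⟫_ℂ := by
  refine (PiTensorProduct.lift.tprod _).trans ?_
  simp

theorem pairLeft_ext {n : ℕ} {f g : AlgTensorPower K n →ₗ[ℂ] ℂ}
    (h : ∀ y, f (algTprod n y) = g (algTprod n y)) : f = g :=
  PiTensorProduct.ext (MultilinearMap.ext h)

/-- The conjugate-linear functional `x ↦ ⟪x, y₀ ⊗ ⋯ ⊗ yₙ₋₁⟫`, as a multilinear function of `y`. -/
def pairRight (n : ℕ) :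
    MultilinearMap ℂ (fun _ : Fin n => K) (AlgTensorPower K n →ₗ⋆[ℂ] ℂ) where
  toFun y :=
    { toFun := fun x => starRingEnd ℂ (pairLeft y x)
      map_add' := fun a b => by simp
      map_smul' := fun c a => by simp }
  map_update_add' {inst} y i a b := by
    obtain rfl : inst = instDecidableEqFin n := Subsingleton.elim _ _
    have h : pairLeft (Function.update y i (a + b)) =
        pairLeft (Function.update y i a) + pairLeft (Function.update y i b) := by
      refine pairLeft_ext fun z => ?_
      rw [LinearMap.add_apply]
      simp only [pairLeft_tprod]
      simp only [← Finset.mul_prod_erase Finset.univ _ (Finset.mem_univ i), Function.update_self,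
        inner_add_left, add_mul]
      congr 2 <;>
      · refine Finset.prod_congr rfl fun j hj => ?_
        simp [Function.update_of_ne (Finset.ne_of_mem_erase hj)]
    ext x
    simp [h]
  map_update_smul' {inst} y i c a := by
    obtain rfl : inst = instDecidableEqFin n := Subsingleton.elim _ _
    have h : pairLeft (Function.update y i (c • a)) =
        starRingEnd ℂ c • pairLeft (Function.update y i a) := by
      refine pairLeft_ext fun z => ?_
      rw [LinearMap.smul_apply]
      simp only [pairLeft_tprod]
      simp only [← Finset.mul_prod_erase Finset.univ _ (Finset.mem_univ i), Function.update_self,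
        inner_smul_left, smul_eq_mul, mul_assoc]
      congr 2
      refine Finset.prod_congr rfl fun j hj => ?_
      simp [Function.update_of_ne (Finset.ne_of_mem_erase hj)]
    ext x
    simp [h]

/-- The sesquilinear form on the tensor power, linear in the first argument written here. -/
def tensorForm (n : ℕ) : AlgTensorPower K n →ₗ[ℂ] AlgTensorPower K n →ₗ⋆[ℂ] ℂ :=
  PiTensorProduct.lift (pairRight n)

theorem tensorForm_tprod {n : ℕ} (x y : Fin n → K) :
    tensorForm n (algTprod n y) (algTprod n x) = ∏ i, ⟪x i, y i⟫_ℂ := by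
  have : tensorForm n (algTprod n y) = pairRight n y := PiTensorProduct.lift.tprod _
  rw [this]
  change starRingEnd ℂ (pairLeft y (algTprod n x)) = _
  simp [pairLeft_tprod]

theorem exists_sum_tprod {n : ℕ} (x : AlgTensorPower K n) :
    ∃ (m : ℕ) (c : Fin m → ℂ) (v : Fin m → Fin n → K), x = ∑ j, c j • algTprod n (v j) := by
  have hx : x ∈ Submodule.span ℂ (Set.range (algTprod (K := K) n)) := by
    rw [algTprod_span]; trivial
  obtain ⟨m, c, g, h⟩ := (Submodule.mem_span_set' (s := Set.range (algTprod (K := K) n))).1 hx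
  choose v hv using fun j => (g j).2
  exact ⟨m, c, v, by rw [← h]; simp [hv]⟩

theorem posSemidef_prod_inner {n m : ℕ} (v : Fin m → Fin n → K) :
    (Matrix.of fun j k => ∏ i, ⟪v j i, v k i⟫_ℂ).PosSemidef := by
  classical
  have key : ∀ s : Finset (Fin n),
      (Matrix.of fun j k => ∏ i ∈ s, ⟪v j i, v k i⟫_ℂ).PosSemidef := by
    intro s
    induction s using Finset.induction_on with
    | empty =>
      have h : (Matrix.of fun _ _ : Fin m => ∏ i ∈ (∅ : Finset (Fin n)), (1 : ℂ)) =
          Matrix.gram ℂ (fun _ : Fin m => (1 : ℂ)) := by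
        ext j k; simp [Matrix.gram]
      have h' := Matrix.posSemidef_gram ℂ (fun _ : Fin m => (1 : ℂ))
      rw [← h] at h'
      simpa using h'
    | insert a s ha ih =>
      have h := (Matrix.posSemidef_gram ℂ (fun j => v j a)).hadamard ih
      have e : (Matrix.of fun j k => ∏ i ∈ insert a s, ⟪v j i, v k i⟫_ℂ) =
          (Matrix.gram ℂ fun j => v j a) ⊙ Matrix.of fun j k => ∏ i ∈ s, ⟪v j i, v k i⟫_ℂ := by
        ext j k
        simp [Finset.prod_insert ha, Matrix.hadamard]
      rw [e]
      exact h
  exact key Finset.univ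

theorem tensorForm_conj {n : ℕ} (x y : AlgTensorPower K n) :
    starRingEnd ℂ (tensorForm n x y) = tensorForm n y x := by
  obtain ⟨m, c, v, rfl⟩ := exists_sum_tprod x
  obtain ⟨m', c', v', rfl⟩ := exists_sum_tprod y
  simp only [map_sum, map_smul, LinearMap.map_smulₛₗ, LinearMap.sum_apply, LinearMap.smul_apply,
    tensorForm_tprod, smul_eq_mul, map_mul, map_prod, inner_conj_symm, Complex.conj_conj,
    Finset.mul_sum]
  rw [Finset.sum_comm]
  refine Finset.sum_congr rfl fun j _ => Finset.sum_congr rfl fun k _ => by ring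

theorem tensorForm_nonneg {n : ℕ} (x : AlgTensorPower K n) :
    0 ≤ (tensorForm n x x).re := by
  obtain ⟨m, c, v, rfl⟩ := exists_sum_tprod x
  have h := (posSemidef_prod_inner v).dotProduct_mulVec_nonneg c
  have h2 := (Complex.le_def.1 h).1
  refine h2.trans (le_of_eq ?_)
  congr 1
  simp only [map_sum, map_smul, LinearMap.map_smulₛₗ, LinearMap.sum_apply, LinearMap.smul_apply,
    tensorForm_tprod, smul_eq_mul, dotProduct, Matrix.mulVec, Matrix.of_apply, Pi.star_apply,
    Finset.mul_sum]
  refine Finset.sum_congr rfl fun j _ => Finset.sum_congr rfl fun k _ => ?_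
  simp only [RCLike.star_def]
  ring

instance (n : ℕ) : PreInnerProductSpace.Core ℂ (AlgTensorPower K n) where
  inner x y := tensorForm n y x
  conj_inner_symm x y := tensorForm_conj _ _
  re_inner_nonneg x := tensorForm_nonneg x
  add_left x y z := by simp
  smul_left x y c := by simp

instance (n : ℕ) : SeminormedAddCommGroup (AlgTensorPower K n) :=
  InnerProductSpace.Core.toSeminormedAddCommGroup (𝕜 := ℂ)

instance (n : ℕ) : InnerProductSpace ℂ (AlgTensorPower K n) := .ofCore _

theorem inner_algTprod {n : ℕ} (x y : Fin n → K) :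
    ⟪algTprod n x, algTprod n y⟫_ℂ = ∏ i, ⟪x i, y i⟫_ℂ :=
  tensorForm_tprod x y

variable (K) in
/-- The Hilbert space tensor power `K^{⊗n}`, the completion of the algebraic tensor power for
`⟪x₀ ⊗ ⋯, y₀ ⊗ ⋯⟫ = ∏ᵢ ⟪xᵢ, yᵢ⟫`. -/
def TensorPower (n : ℕ) : Type _ := UniformSpace.Completion (AlgTensorPower K n)

instance (n : ℕ) : NormedAddCommGroup (TensorPower K n) :=
  inferInstanceAs (NormedAddCommGroup (UniformSpace.Completion (AlgTensorPower K n)))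

instance (n : ℕ) : InnerProductSpace ℂ (TensorPower K n) :=
  inferInstanceAs (InnerProductSpace ℂ (UniformSpace.Completion (AlgTensorPower K n)))

instance (n : ℕ) : CompleteSpace (TensorPower K n) :=
  inferInstanceAs (CompleteSpace (UniformSpace.Completion (AlgTensorPower K n)))

/-- The canonical map from the algebraic tensor power to its completion. -/
def toTensorPower (n : ℕ) : AlgTensorPower K n →ₗᵢ[ℂ] TensorPower K n :=
  UniformSpace.Completion.toComplₗᵢ

theorem denseRange_toTensorPower (n : ℕ) : DenseRange (toTensorPower (K := K) n) :=
  UniformSpace.Completion.denseRange_coe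

/-- The elementary tensor in the Hilbert space tensor power. -/
def tprod {n : ℕ} (x : Fin n → K) : TensorPower K n := toTensorPower n (algTprod n x)

theorem inner_tprod {n : ℕ} (x y : Fin n → K) :
    ⟪tprod x, tprod y⟫_ℂ = ∏ i, ⟪x i, y i⟫_ℂ := by
  rw [tprod, tprod, LinearIsometry.inner_map_map, inner_algTprod]

/-- The permutation `x₀ ⊗ ⋯ ⊗ xₙ₋₁ ↦ x_{σ⁻¹ 0} ⊗ ⋯ ⊗ x_{σ⁻¹ (n-1)}` of the tensor factors. -/
def algPerm {n : ℕ} (σ : Equiv.Perm (Fin n)) : AlgTensorPower K n →ₗ[ℂ] AlgTensorPower K n :=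
  (PiTensorProduct.reindex ℂ (fun _ => K) σ).toLinearMap

theorem algPerm_tprod {n : ℕ} (σ : Equiv.Perm (Fin n)) (x : Fin n → K) :
    algPerm σ (algTprod n x) = algTprod n (fun i => x (σ.symm i)) :=
  PiTensorProduct.reindex_tprod σ x

theorem inner_algPerm {n : ℕ} (σ : Equiv.Perm (Fin n)) (x y : AlgTensorPower K n) :
    ⟪algPerm σ x, algPerm σ y⟫_ℂ = ⟪x, y⟫_ℂ := by
  obtain ⟨m, c, v, rfl⟩ := exists_sum_tprod x
  obtain ⟨m', c', v', rfl⟩ := exists_sum_tprod y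
  simp only [map_sum, map_smul, algPerm_tprod, sum_inner, inner_sum, inner_smul_left,
    inner_smul_right, inner_algTprod]
  refine Finset.sum_congr rfl fun j _ => congrArg _ (Finset.sum_congr rfl fun k _ => congrArg _ ?_)
  exact Equiv.prod_comp σ.symm (fun i => ⟪v k i, v' j i⟫_ℂ)

/-- The unitary on `K^{⊗n}` that permutes the tensor factors by `σ`. -/
def permOp {n : ℕ} (σ : Equiv.Perm (Fin n)) : TensorPower K n →L[ℂ] TensorPower K n :=
  ((algPerm σ).isometryOfInner (inner_algPerm σ)).toContinuousLinearMap.completion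

theorem permOp_tprod {n : ℕ} (σ : Equiv.Perm (Fin n)) (x : Fin n → K) :
    permOp σ (tprod x) = tprod (fun i => x (σ.symm i)) := by
  refine (ContinuousLinearMap.completion_apply_coe _ _).trans ?_
  exact congrArg (toTensorPower n) (algPerm_tprod σ x)

theorem inner_permOp {n : ℕ} (σ : Equiv.Perm (Fin n)) (x y : TensorPower K n) :
    ⟪permOp σ x, permOp σ y⟫_ℂ = ⟪x, y⟫_ℂ := by
  have h : ∀ a : AlgTensorPower K n,
      permOp σ (toTensorPower n a) = toTensorPower n (algPerm σ a) := fun a =>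
    ContinuousLinearMap.completion_apply_coe _ _
  refine (denseRange_toTensorPower n).induction_on₂
    (isClosed_eq (by fun_prop) (by fun_prop)) (fun a b => ?_) x y
  rw [h, h, LinearIsometry.inner_map_map, LinearIsometry.inner_map_map, inner_algPerm]

variable (K) in
/-- The symmetric tensor power: the vectors of `K^{⊗n}` fixed by all permutations of the
factors. -/
def SymPower (n : ℕ) : Submodule ℂ (TensorPower K n) :=
  ⨅ σ : Equiv.Perm (Fin n), LinearMap.eqLocus (permOp σ).toLinearMap LinearMap.id

theorem mem_symPower {n : ℕ} {x : TensorPower K n} :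
    x ∈ SymPower K n ↔ ∀ σ : Equiv.Perm (Fin n), permOp σ x = x := by
  simp [SymPower, Submodule.mem_iInf, LinearMap.mem_eqLocus]

instance (n : ℕ) : CompleteSpace (SymPower K n) := by
  suffices h : IsClosed (SymPower K n : Set (TensorPower K n)) from h.completeSpace_coe
  have : (SymPower K n : Set (TensorPower K n)) =
      ⋂ σ : Equiv.Perm (Fin n), {x | permOp σ x = x} := by
    ext x; simp [mem_symPower]
  rw [this]
  exact isClosed_iInter fun σ => isClosed_eq (permOp σ).continuous continuous_id

variable (K) in
/-- The symmetric Fock space `Γ(K)`, the Hilbert space direct sum of the symmetric tensor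
powers. -/
abbrev Fock : Type _ := lp (fun n : ℕ => SymPower K n) 2

/-- `u^{⊗n}`. -/
def tpow (n : ℕ) (u : K) : SymPower K n :=
  ⟨tprod (fun _ => u), mem_symPower.2 fun σ => permOp_tprod σ _⟩

theorem inner_tpow (n : ℕ) (u v : K) : ⟪tpow n u, tpow n v⟫_ℂ = ⟪u, v⟫_ℂ ^ n := by
  rw [Submodule.coe_inner, tpow, tpow, inner_tprod]
  simp

theorem norm_tpow (n : ℕ) (u : K) : ‖tpow n u‖ = ‖u‖ ^ n := by
  have h := inner_tpow n u u
  rw [inner_self_eq_norm_sq_to_K, inner_self_eq_norm_sq_to_K, ← pow_mul, mul_comm 2 n,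
    pow_mul] at h
  have h' : ‖tpow n u‖ ^ 2 = (‖u‖ ^ n) ^ 2 := by exact_mod_cast h
  exact (pow_left_inj₀ (norm_nonneg _) (by positivity) two_ne_zero).1 h'

theorem memℓp_expVec (u : K) :
    Memℓp (fun n : ℕ => ((Real.sqrt n.factorial : ℂ)⁻¹ • tpow n u : SymPower K n)) 2 := by
  refine memℓp_gen ?_
  have h := Real.summable_pow_div_factorial (‖u‖ ^ 2)
  refine h.congr fun n => ?_
  rw [norm_smul, norm_tpow]
  simp only [ENNReal.toReal_ofNat, Real.rpow_ofNat, norm_inv, Complex.norm_real, Real.norm_eq_abs]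
  rw [abs_of_nonneg (Real.sqrt_nonneg _), mul_pow, inv_pow, Real.sq_sqrt (by positivity)]
  rw [← pow_mul, ← pow_mul, mul_comm n 2]
  field_simp

/-- The exponential vector `e(u) = ∑ₙ u^{⊗n} / √n!`. -/
def expVec (u : K) : Fock K :=
  ⟨fun n => (Real.sqrt n.factorial : ℂ)⁻¹ • tpow n u, memℓp_expVec u⟩

theorem expVec_apply (u : K) (n : ℕ) :
    (expVec u : Fock K) n = (Real.sqrt n.factorial : ℂ)⁻¹ • tpow n u := rfl

theorem inner_expVec (u v : K) : ⟪expVec u, expVec v⟫_ℂ = Complex.exp ⟪u, v⟫_ℂ := by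
  rw [lp.inner_eq_tsum, Complex.exp_eq_exp_ℂ, NormedSpace.exp_eq_tsum_div]
  refine tsum_congr fun n => ?_
  rw [expVec_apply, expVec_apply, inner_smul_left, inner_smul_right, inner_tpow]
  have h : (Real.sqrt n.factorial : ℂ) * (Real.sqrt n.factorial : ℂ) = (n.factorial : ℂ) := by
    rw [← Complex.ofReal_mul, Real.mul_self_sqrt (by positivity)]; simp
  have h0 : (Real.sqrt n.factorial : ℂ) ≠ 0 := by
    exact_mod_cast (Real.sqrt_pos.2 (Nat.cast_pos.2 n.factorial_pos)).ne'
  simp only [map_inv₀, Complex.conj_ofReal]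
  rw [← h]
  field_simp

theorem tpow_smul (n : ℕ) (z : ℂ) (u : K) : tpow n (z • u) = z ^ n • tpow n u := by
  apply Subtype.ext
  change tprod (fun _ => z • u) = z ^ n • tprod (fun _ => u)
  rw [tprod, tprod, ← map_smul]
  congr 1
  have h := (algTprod (K := K) n).map_smul_univ (fun _ => z) (fun _ => u)
  simpa using h

/-- Polarization: a symmetric tensor orthogonal to all `u^{⊗n}` vanishes. -/
theorem eq_zero_of_inner_tpow {n : ℕ} (ξ : SymPower K n) (h : ∀ u : K, ⟪ξ, tpow n u⟫_ℂ = 0) :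
    ξ = 0 := by
  let f : MultilinearMap ℂ (fun _ : Fin n => K) ℂ :=
    ((innerSL ℂ (ξ : TensorPower K n)).toLinearMap ∘ₗ
      (toTensorPower n).toLinearMap).compMultilinearMap (algTprod n)
  have hf : ∀ x, f x = ⟪(ξ : TensorPower K n), tprod x⟫_ℂ := fun x => rfl
  have hnorm : ∀ x : Fin n → K, ‖tprod x‖ = ∏ i, ‖x i‖ := fun x => by
    have h1 := inner_tprod x x
    simp only [inner_self_eq_norm_sq_to_K] at h1
    rw [Finset.prod_pow] at h1
    have h2 : ‖tprod x‖ ^ 2 = (∏ i, ‖x i‖) ^ 2 := by exact_mod_cast h1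
    exact (pow_left_inj₀ (norm_nonneg _)
      (Finset.prod_nonneg fun _ _ => norm_nonneg _) two_ne_zero).1 h2
  let F := f.mkContinuous ‖(ξ : TensorPower K n)‖ (fun x => by
    rw [hf, ← hnorm]; exact norm_inner_le_norm _ _)
  have hF : ∀ x, F x = ⟪(ξ : TensorPower K n), tprod x⟫_ℂ := fun x => rfl
  have hdiag : (fun u : K => F (fun _ => u)) = fun _ => 0 := by
    funext u
    exact (hF _).trans (h u)
  have hzero : ∀ x : Fin n → K, ⟪(ξ : TensorPower K n), tprod x⟫_ℂ = 0 := by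
    intro x
    have h1 := F.iteratedFDeriv_comp_diagonal 0 x
    rw [hdiag] at h1
    have h2 : iteratedFDeriv ℂ n (fun _ : K => (0 : ℂ)) 0 x = 0 := by
      have : iteratedFDeriv ℂ n (fun _ : K => (0 : ℂ)) = 0 := iteratedFDeriv_fun_zero
      rw [this]; rfl
    rw [h2] at h1
    have h3 : ∀ σ : Equiv.Perm (Fin n), F (fun i => x (σ i)) = F x := by
      intro σ
      rw [hF, hF]
      have h4 := permOp_tprod σ (fun i => x (σ i))
      simp only [Equiv.apply_symm_apply] at h4
      have h5 : ⟪permOp σ (ξ : TensorPower K n), permOp σ (tprod fun i => x (σ i))⟫_ℂ =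
          ⟪(ξ : TensorPower K n), tprod fun i => x (σ i)⟫_ℂ := inner_permOp σ _ _
      rw [h4, mem_symPower.1 ξ.2 σ] at h5
      exact h5.symm
    rw [Finset.sum_congr rfl (fun σ _ => h3 σ)] at h1
    simp only [Finset.sum_const, nsmul_eq_mul] at h1
    have h6 : ((Finset.univ : Finset (Equiv.Perm (Fin n))).card : ℂ) ≠ 0 := by
      simp [Fintype.card_perm, Nat.factorial_ne_zero]
    exact (mul_eq_zero.1 h1.symm).resolve_left h6
  have hall : ∀ y : AlgTensorPower K n, ⟪(ξ : TensorPower K n), toTensorPower n y⟫_ℂ = 0 := by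
    intro y
    obtain ⟨m, c, v, rfl⟩ := exists_sum_tprod y
    simp only [map_sum, map_smul, inner_sum, inner_smul_right]
    exact Finset.sum_eq_zero fun j _ => by
      have := hzero (v j)
      rw [tprod] at this
      rw [this, mul_zero]
  apply Subtype.ext
  exact (denseRange_toTensorPower n).eq_zero_of_inner_left ℂ hall

theorem eq_zero_of_inner_expVec (ξ : Fock K) (h : ∀ u : K, ⟪ξ, expVec u⟫_ℂ = 0) : ξ = 0 := by
  ext1
  funext n
  refine eq_zero_of_inner_tpow _ fun u => ?_
  let g : ℕ → ℂ := fun n => (Real.sqrt n.factorial : ℂ)⁻¹ * ⟪ξ n, tpow n u⟫_ℂ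
  have hs : ∀ z : ℂ, HasSum (fun n => z ^ n • g n) 0 := by
    intro z
    have h1 := lp.hasSum_inner (𝕜 := ℂ) ξ (expVec (z • u))
    rw [h] at h1
    refine h1.congr_fun ?_
    intro n
    rw [expVec_apply, inner_smul_right, tpow_smul, inner_smul_right]
    simp only [g, smul_eq_mul]
    ring
  have hp : HasFPowerSeriesAt (0 : ℂ → ℂ) (FormalMultilinearSeries.ofScalars ℂ g) 0 := by
    rw [hasFPowerSeriesAt_iff]
    refine Filter.Eventually.of_forall fun z => ?_
    simpa [FormalMultilinearSeries.coeff_ofScalars] using hs z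
  have h0 := hp.eq_zero
  have h1 : g n = 0 := by
    rw [← FormalMultilinearSeries.coeff_ofScalars (𝕜 := ℂ) (p := g) (n := n), h0]
    rfl
  have hne : (Real.sqrt n.factorial : ℂ)⁻¹ ≠ 0 := by
    rw [ne_eq, inv_eq_zero]
    exact_mod_cast (Real.sqrt_pos.2 (Nat.cast_pos.2 n.factorial_pos)).ne'
  exact (mul_eq_zero.1 h1).resolve_left hne

variable (K) in
/-- The linear map from formal linear combinations of vectors of `K` that sends `v` to `e(v)`. -/
def expComb : (K →₀ ℂ) →ₗ[ℂ] Fock K := Finsupp.linearCombination ℂ expVec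

theorem denseRange_expComb : DenseRange (expComb K) := by
  have h : (LinearMap.range (expComb K)).topologicalClosure = ⊤ := by
    rw [Submodule.topologicalClosure_eq_top_iff, Submodule.eq_bot_iff]
    intro ξ hξ
    refine eq_zero_of_inner_expVec ξ fun u => ?_
    exact Submodule.inner_left_of_mem_orthogonal
      (K := LinearMap.range (expComb K)) ⟨Finsupp.single u 1, by simp [expComb]⟩ hξ
  have h' := congrArg (fun S : Submodule ℂ (Fock K) => (S : Set (Fock K))) h
  simp only [Submodule.topologicalClosure_coe, Submodule.top_coe] at h'
  exact dense_iff_closure_eq.2 ((congrArg closure (LinearMap.coe_range _).symm).trans h')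

/-- The vector `e^{-‖u‖²/2 - ⟪u, v⟫} e(u + v)`. -/
def weylVec (u v : K) : Fock K :=
  Complex.exp (-((‖u‖ : ℂ) ^ 2) / 2 - ⟪u, v⟫_ℂ) • expVec (u + v)

theorem inner_weylVec (u v w : K) : ⟪weylVec u v, weylVec u w⟫_ℂ = ⟪expVec v, expVec w⟫_ℂ := by
  simp only [weylVec, inner_smul_left, inner_smul_right, inner_expVec, ← Complex.exp_conj,
    ← Complex.exp_add]
  congr 1
  simp only [map_sub, map_neg, map_div₀, map_pow, Complex.conj_ofReal, inner_conj_symm,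
    inner_add_left, inner_add_right, inner_self_eq_norm_sq_to_K, map_ofNat]
  simp only [Complex.coe_algebraMap]
  ring

theorem norm_linearCombination_weylVec (u : K) (x : K →₀ ℂ) :
    ‖Finsupp.linearCombination ℂ (weylVec u) x‖ = ‖expComb K x‖ := by
  have h : ⟪Finsupp.linearCombination ℂ (weylVec u) x,
      Finsupp.linearCombination ℂ (weylVec u) x⟫_ℂ = ⟪expComb K x, expComb K x⟫_ℂ := by
    simp only [expComb, Finsupp.linearCombination_apply, Finsupp.sum, sum_inner, inner_sum,
      inner_smul_left, inner_smul_right, inner_weylVec]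
  rw [inner_self_eq_norm_sq_to_K, inner_self_eq_norm_sq_to_K] at h
  have h2 : ‖Finsupp.linearCombination ℂ (weylVec u) x‖ ^ 2 = ‖expComb K x‖ ^ 2 := by
    exact_mod_cast h
  exact (pow_left_inj₀ (norm_nonneg _) (norm_nonneg _) two_ne_zero).1 h2

/-- The Weyl operator `W(u)`, the continuous linear extension of
`e(v) ↦ e^{-‖u‖²/2 - ⟪u, v⟫} e(u + v)`. -/
def weyl (u : K) : Fock K →L[ℂ] Fock K :=
  (Finsupp.linearCombination ℂ (weylVec u)).extendOfNorm (expComb K)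

theorem weyl_expVec (u v : K) :
    weyl u (expVec v) =
      Complex.exp (-((‖u‖ : ℂ) ^ 2) / 2 - ⟪u, v⟫_ℂ) • expVec (u + v) := by
  have h := LinearMap.extendOfNorm_eq (f := Finsupp.linearCombination ℂ (weylVec u))
    denseRange_expComb ⟨1, fun x => by rw [one_mul, norm_linearCombination_weylVec]⟩
    (Finsupp.single v 1)
  simpa [expComb, weyl, weylVec] using h

theorem clm_ext_expVec {E : Type*} [NormedAddCommGroup E] [NormedSpace ℂ E]
    {S T : Fock K →L[ℂ] E} (h : ∀ v : K, S (expVec v) = T (expVec v)) : S = T := by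
  have h' : S ∘ expComb K = T ∘ expComb K := by
    funext x
    simp [expComb, Finsupp.linearCombination_apply, Finsupp.sum, h]
  ext1 x
  exact congrFun (denseRange_expComb.equalizer S.continuous T.continuous h') x

theorem weyl_mul (u v : K) :
    weyl u * weyl v = Complex.exp (-((⟪u, v⟫_ℂ).im : ℂ) * Complex.I) • weyl (u + v) := by
  refine clm_ext_expVec fun w => ?_
  simp only [mul_apply_eq_comp, _root_.smul_apply, weyl_expVec, map_smul,
    smul_smul, ← Complex.exp_add, add_assoc]
  congr 2
  have e1 : ((‖u + v‖ : ℂ)) ^ 2 = ⟪u + v, u + v⟫_ℂ := (inner_self_eq_norm_sq_to_K (𝕜 := ℂ) (u + v)).symm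
  have e2 : ((‖u‖ : ℂ)) ^ 2 = ⟪u, u⟫_ℂ := (inner_self_eq_norm_sq_to_K (𝕜 := ℂ) (u)).symm
  have e3 : ((‖v‖ : ℂ)) ^ 2 = ⟪v, v⟫_ℂ := (inner_self_eq_norm_sq_to_K (𝕜 := ℂ) (v)).symm
  have e4 : ⟪v, u⟫_ℂ = starRingEnd ℂ ⟪u, v⟫_ℂ := (inner_conj_symm _ _).symm
  rw [e1, e2, e3]
  have r4 : (⟪v, u⟫_ℂ).re = (⟪u, v⟫_ℂ).re := by rw [e4, Complex.conj_re]
  have i4 : (⟪v, u⟫_ℂ).im = -(⟪u, v⟫_ℂ).im := by rw [e4, Complex.conj_im]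
  simp only [inner_add_left, inner_add_right]
  apply Complex.ext
  · simp [r4]
    ring
  · simp [i4]
    ring

theorem weyl_zero : weyl (0 : K) = 1 :=
  clm_ext_expVec fun w => by simp [weyl_expVec]

theorem inner_weyl (u : K) (x y : Fock K) : ⟪weyl u x, weyl u y⟫_ℂ = ⟪x, y⟫_ℂ := by
  have h : ∀ x : Fock K, ‖weyl u x‖ = ‖x‖ := by
    have h1 : (fun x : Fock K => ‖weyl u x‖) ∘ expComb K = (fun x => ‖x‖) ∘ expComb K := by
      funext x
      have h2 := LinearMap.extendOfNorm_eq (f := Finsupp.linearCombination ℂ (weylVec u))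
        denseRange_expComb ⟨1, fun x => by rw [one_mul, norm_linearCombination_weylVec]⟩ x
      simp only [Function.comp_apply, weyl, h2, norm_linearCombination_weylVec]
    intro x
    exact congrFun (denseRange_expComb.equalizer (weyl u).continuous.norm continuous_norm h1) x
  exact LinearIsometry.inner_map_map ⟨(weyl u).toLinearMap, h⟩ x y

theorem weyl_mem_unitary (u : K) : weyl u ∈ unitary (Fock K →L[ℂ] Fock K) := by
  have h1 : star (weyl u) * weyl u = 1 := by
    ext1 x
    refine ext_inner_right ℂ fun y => ?_
    rw [mul_apply_eq_comp, ContinuousLinearMap.star_eq_adjoint,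
      ContinuousLinearMap.adjoint_inner_left, inner_weyl]
    rfl
  have h2 : weyl u * weyl (-u) = 1 := by
    rw [weyl_mul]
    have h0 : (⟪u, u⟫_ℂ).im = 0 := inner_self_im (𝕜 := ℂ) u
    rw [inner_neg_right, Complex.neg_im, h0, add_neg_cancel, weyl_zero]
    simp
  have h3 : star (weyl u) = weyl (-u) := left_inv_eq_right_inv h1 h2
  exact Unitary.mem_iff.2 ⟨h1, by rw [h3]; exact h2⟩

section Semigroups

variable {H : Type*} [NormedAddCommGroup H] [InnerProductSpace ℂ H] [CompleteSpace H]

/-- A functional on `B(H)` belongs to the predual `B(H)_*` (the trace class operators acting by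
the trace) if it is of the form `T ↦ ∑ₙ ⟪ξₙ, T ηₙ⟫` with square summable sequences `ξ`, `η`
in `H`. -/
def IsNormalFunctional (ρ : (H →L[ℂ] H) →ₗ[ℂ] ℂ) : Prop :=
  ∃ ξ η : lp (fun _ : ℕ => H) 2, ∀ T : H →L[ℂ] H, ρ T = ∑' n, ⟪ξ n, T (η n)⟫_ℂ

variable (H) in
/-- The σ-weak topology on `B(H)`: the weak topology given by the predual. -/
abbrev sigmaWeak : TopologicalSpace (H →L[ℂ] H) :=
  ⨅ ρ : {ρ : (H →L[ℂ] H) →ₗ[ℂ] ℂ // IsNormalFunctional ρ}, TopologicalSpace.induced ρ.1 inferInstance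

/-- A `*`-endomorphism of `B(H)`, not assumed unital, is normal if it is σ-weakly continuous. -/
def IsNormalEndo (φ : (H →L[ℂ] H) →⋆ₙₐ[ℂ] (H →L[ℂ] H)) : Prop :=
  @Continuous _ _ (sigmaWeak H) (sigmaWeak H) φ

/-- An E-semigroup on `B(H)` over a closed convex cone `P`: a semigroup of normal
`*`-endomorphisms of `B(H)` indexed by `P`, continuous against the predual. -/
structure IsESemigroup {d : ℕ} (P : ProperCone ℝ (EuclideanSpace ℝ (Fin d)))
    (α : P → (H →L[ℂ] H) →⋆ₙₐ[ℂ] (H →L[ℂ] H)) : Prop where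
  normal : ∀ x, IsNormalEndo (α x)
  map_zero : ∀ T, α 0 T = T
  map_add : ∀ x y T, α (x + y) T = α x (α y T)
  continuous : ∀ ρ : (H →L[ℂ] H) →ₗ[ℂ] ℂ, IsNormalFunctional ρ → ∀ T, Continuous fun x => ρ (α x T)

/-- An E₀-semigroup is a unital E-semigroup. -/
structure IsE0Semigroup {d : ℕ} (P : ProperCone ℝ (EuclideanSpace ℝ (Fin d)))
    (α : P → (H →L[ℂ] H) →⋆ₙₐ[ℂ] (H →L[ℂ] H)) : Prop extends IsESemigroup P α where
  unital : ∀ x, α x 1 = 1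

/-- A strongly continuous representation of the cone `P` by isometries. -/
structure IsIsometricRep {d : ℕ} (P : ProperCone ℝ (EuclideanSpace ℝ (Fin d)))
    (V : P → H →L[ℂ] H) : Prop where
  isometry : ∀ x, Isometry (V x)
  map_add : ∀ x y, V (x + y) = V x ∘L V y
  continuous : ∀ ξ, Continuous fun x => V x ξ

end Semigroups

end CCR

end

/-! For one isometry `V`, split `K = VK ⊕ (VK)ᗮ`. The exponential law gives a unitary `U` from
`Γ(K)` onto `Γ((VK)ᗮ) ⊗ Γ(K)`, `e(u) ↦ e(u - VV*u) ⊗ e(V*u)`, and the endomorphism is `T ↦ U*(1 ⊗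
T)U`. It sends `W(k)` to `W(Vk)`: translating `v` by `Vk` leaves the first factor alone and
translates `V*v` by `k`, while `‖Vk‖ = ‖k‖` and `⟪Vk, v⟫ = ⟪k, V*v⟫` make the scalars agree. A
Hilbert basis indexed by `ι` turns the tensor product into `ℓ²(ι, Γ(K))` and `1 ⊗ T` into `amp ι T`
(`exists_factorization`, `exists_conjAmp_weyl`). Separability makes `ι` countable, which gives
normality (`isNormalEndo_conjAmp`).

Uniqueness holds because a normal functional vanishing on all Weyl operators is zero
(`inner_amp_eq_zero`). This is von Neumann's bicommutant argument on `ℓ²(ι, Γ(K))`, fed by the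
irreducibility of the Weyl operators (`exists_eq_smul_one_of_commute_weyl`). So normal endomorphisms
are compared on Weyl operators only (`isNormalEndo_ext`), and the semigroup law reduces to `V_{x+y}
= V_x V_y`.

For continuity in `x`, the coefficient of `α_x(T)` between `e(u)` and `e(v)` depends on `x` only
through `V_x*u` and `V_x*v`. Strong continuity of the adjoints follows from the semigroup law and
the spanning property of the cone (`IsIsometricRep.continuous_adjoint`); the bound `‖α_x(T)‖ ≤ ‖T‖`
then passes from exponential vectors to all of the predual. -/

noncomputable section

namespace CCR

open scoped InnerProductSpace

/-! ### Amplification of operators to `ℓ²(ι, H)` -/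

section Amplification

variable {H : Type*} [NormedAddCommGroup H] [InnerProductSpace ℂ H]

/-- The amplification `⨁ T` of an operator `T` on `H` to `ℓ²(ι, H)`. -/
def amp (ι : Type*) (T : H →L[ℂ] H) : lp (fun _ : ι => H) 2 →L[ℂ] lp (fun _ : ι => H) 2 :=
  LinearMap.mkContinuous
    { toFun := fun ξ => ⟨fun i => T (ξ i), by
        refine Memℓp.of_norm ?_
        have h : Memℓp (fun i => ‖T‖ • ‖ξ i‖) 2 := ((lp.memℓp ξ).norm).const_smul ‖T‖
        exact h.mono' fun i => by simpa using T.le_opNorm (ξ i)⟩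
      map_add' := fun ξ η => by ext i; exact map_add T _ _
      map_smul' := fun c ξ => by ext i; exact map_smul T c _ }
    ‖T‖ (fun ξ => by
      refine lp.norm_le_of_forall_sum_le (by norm_num) (by positivity) fun s => ?_
      have h := lp.sum_rpow_le_norm_rpow (p := 2) (by norm_num) ξ s
      simp only [ENNReal.toReal_ofNat, Real.rpow_ofNat] at h ⊢
      rw [mul_pow]
      refine le_trans ?_ (mul_le_mul_of_nonneg_left h (by positivity))
      rw [Finset.mul_sum]
      refine Finset.sum_le_sum fun i _ => ?_
      rw [← mul_pow]
      exact pow_le_pow_left₀ (norm_nonneg _) (T.le_opNorm (ξ i)) 2)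

@[simp]
theorem amp_apply {ι : Type*} (T : H →L[ℂ] H) (ξ : lp (fun _ : ι => H) 2) (i : ι) :
    amp ι T ξ i = T (ξ i) := rfl

variable [CompleteSpace H]

/-- Amplification as a `*`-homomorphism. -/
def ampHom (ι : Type*) :
    (H →L[ℂ] H) →⋆ₐ[ℂ] (lp (fun _ : ι => H) 2 →L[ℂ] lp (fun _ : ι => H) 2) where
  toFun := amp ι
  map_one' := by ext; simp
  map_mul' S T := by ext; simp
  map_zero' := by ext; simp
  map_add' S T := by ext; simp
  commutes' c := by ext; simp [Algebra.algebraMap_eq_smul_one]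
  map_star' T := by
    rw [ContinuousLinearMap.star_eq_adjoint, ContinuousLinearMap.star_eq_adjoint,
      ContinuousLinearMap.eq_adjoint_iff]
    intro ξ η
    rw [lp.inner_eq_tsum, lp.inner_eq_tsum]
    exact tsum_congr fun i => ContinuousLinearMap.adjoint_inner_left _ _ _

end Amplification

/-! ### Exponential vectors: continuity, totality, separability -/

section Exponential

variable {K : Type*} [NormedAddCommGroup K] [InnerProductSpace ℂ K]

/-- The squared distance between two exponential vectors is a continuous expression in the kernel
`exp ⟪u, v⟫`. -/
theorem continuous_expVec : Continuous (expVec : K → Fock K) := by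
  rw [continuous_iff_continuousAt]
  intro u
  rw [ContinuousAt, tendsto_iff_norm_sub_tendsto_zero]
  have h : ∀ v : K, ‖expVec v - expVec u‖ =
      √((Complex.exp ⟪v, v⟫_ℂ - Complex.exp ⟪v, u⟫_ℂ
        - Complex.exp ⟪u, v⟫_ℂ + Complex.exp ⟪u, u⟫_ℂ).re) := by
    intro v
    rw [norm_eq_sqrt_re_inner (𝕜 := ℂ), inner_sub_left, inner_sub_right, inner_sub_right,
      inner_expVec, inner_expVec, inner_expVec, inner_expVec]
    congr 1
    simp only [RCLike.re_to_complex]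
    congr 1
    ring
  simp only [h]
  have hc : Continuous fun v : K => √((Complex.exp ⟪v, v⟫_ℂ - Complex.exp ⟪v, u⟫_ℂ
        - Complex.exp ⟪u, v⟫_ℂ + Complex.exp ⟪u, u⟫_ℂ).re) := by fun_prop
  simpa using hc.tendsto u

/-- The continuous image of `K` under `expVec` is separable and has dense span. Applied to `(VK)ᗮ`,
this makes the index set of a Hilbert basis countable. -/
instance [TopologicalSpace.SeparableSpace K] : TopologicalSpace.SeparableSpace (Fock K) := by
  have h1 : TopologicalSpace.IsSeparable (Set.range (expVec : K → Fock K)) :=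
    TopologicalSpace.isSeparable_range continuous_expVec
  have h2 := (h1.span (R := ℂ)).closure
  have h3 : closure (Submodule.span ℂ (Set.range (expVec : K → Fock K)) : Set (Fock K)) =
      Set.univ := by
    have := (denseRange_expComb (K := K)).closure_range
    rwa [← LinearMap.coe_range, expComb, Finsupp.range_linearCombination] at this
  rw [h3] at h2
  exact TopologicalSpace.isSeparable_univ_iff.1 h2

theorem dense_span_range_expVec :
    Dense (Submodule.span ℂ (Set.range (expVec : K → Fock K)) : Set (Fock K)) := by
  have := denseRange_expComb (K := K)
  rwa [DenseRange, ← LinearMap.coe_range, expComb, Finsupp.range_linearCombination] at this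

/-- A map with the same Gram kernel as `u ↦ e(u)` extends to an isometry of the Fock space. -/
theorem exists_linearIsometry_expVec {E : Type*} [NormedAddCommGroup E] [InnerProductSpace ℂ E]
    [CompleteSpace E] (f : K → E) (hf : ∀ u v, ⟪f u, f v⟫_ℂ = Complex.exp ⟪u, v⟫_ℂ) :
    ∃ U : Fock K →ₗᵢ[ℂ] E, ∀ u, U (expVec u) = f u := by
  have hnorm : ∀ x : K →₀ ℂ, ‖Finsupp.linearCombination ℂ f x‖ = ‖expComb K x‖ := by
    intro x
    have h : ⟪Finsupp.linearCombination ℂ f x, Finsupp.linearCombination ℂ f x⟫_ℂ =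
        ⟪expComb K x, expComb K x⟫_ℂ := by
      simp only [expComb, Finsupp.linearCombination_apply, Finsupp.sum, sum_inner, inner_sum,
        inner_smul_left, inner_smul_right, hf, inner_expVec]
    rw [norm_eq_sqrt_re_inner (𝕜 := ℂ), h, ← norm_eq_sqrt_re_inner]
  let T := (Finsupp.linearCombination ℂ f).extendOfNorm (expComb K)
  have hT : ∀ x, T (expComb K x) = Finsupp.linearCombination ℂ f x := fun x =>
    LinearMap.extendOfNorm_eq denseRange_expComb ⟨1, fun x => by rw [one_mul, hnorm]⟩ x
  have h1 : (fun x => ‖T x‖) ∘ expComb K = (fun x => ‖x‖) ∘ expComb K := by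
    funext x
    simp only [Function.comp_apply, hT, hnorm]
  refine ⟨⟨T.toLinearMap, fun x => congrFun
    (denseRange_expComb.equalizer T.continuous.norm continuous_norm h1) x⟩, fun u => ?_⟩
  have := hT (Finsupp.single u 1)
  simpa [expComb] using this

end Exponential

/-- Orthonormal vectors lie at distance `√2`, so the balls of radius `1/2` around them are disjoint
open sets. -/
theorem _root_.Orthonormal.countable_of_separableSpace {E ι : Type*} [NormedAddCommGroup E]
    [InnerProductSpace ℂ E] [TopologicalSpace.SeparableSpace E] {v : ι → E}
    (hv : Orthonormal ℂ v) : Countable ι := by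
  rw [← Set.countable_univ_iff]
  refine Set.PairwiseDisjoint.countable_of_isOpen (s := fun i => Metric.ball (v i) (1 / 2))
    (fun i _ j _ hij => ?_) (fun i _ => Metric.isOpen_ball)
    (fun i _ => ⟨v i, Metric.mem_ball_self (by norm_num)⟩)
  refine Metric.ball_disjoint_ball ?_
  have h : ‖v i - v j‖ * ‖v i - v j‖ = 1 * 1 + 1 * 1 := by
    rw [norm_sub_mul_self (𝕜 := ℂ), hv.2 hij, hv.1, hv.1]
    simp
  rw [dist_eq_norm]
  nlinarith [norm_nonneg (v i - v j)]

/-! ### The unitary `Γ(K) ≃ Γ((VK)ᗮ) ⊗ Γ(K)` -/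

section Factorization

variable {K : Type*} [NormedAddCommGroup K] [InnerProductSpace ℂ K] [CompleteSpace K]
  {V : K →L[ℂ] K}

theorem adjoint_apply_of_isometry (hV : Isometry V) (u : K) : V.adjoint (V u) = u := by
  have h := (ContinuousLinearMap.norm_map_iff_adjoint_comp_self V).1
    fun x => hV.norm_map_of_map_zero (map_zero V) x
  exact congrArg (fun T : K →L[ℂ] K => T u) h

/-- The component of `u` orthogonal to the range of the isometry `V`. -/
def defectPart (hV : Isometry V) (u : K) : (LinearMap.range V.toLinearMap)ᗮ :=
  ⟨u - V (V.adjoint u), by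
    rw [Submodule.mem_orthogonal]
    rintro _ ⟨y, rfl⟩
    change ⟪V y, _⟫_ℂ = 0
    rw [← ContinuousLinearMap.adjoint_inner_right, map_sub, adjoint_apply_of_isometry hV,
      sub_self, inner_zero_right]⟩

theorem inner_defectPart (hV : Isometry V) (u v : K) :
    ⟪defectPart hV u, defectPart hV v⟫_ℂ = ⟪u, v⟫_ℂ - ⟪V.adjoint u, V.adjoint v⟫_ℂ := by
  rw [Submodule.coe_inner]
  change ⟪u - V (V.adjoint u), v - V (V.adjoint v)⟫_ℂ = _
  have h1 : ∀ x y : K, ⟪V x, y⟫_ℂ = ⟪x, V.adjoint y⟫_ℂ := fun x y =>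
    (ContinuousLinearMap.adjoint_inner_right V x y).symm
  have h2 : ∀ x y : K, ⟪x, V y⟫_ℂ = ⟪V.adjoint x, y⟫_ℂ := fun x y =>
    (ContinuousLinearMap.adjoint_inner_left V y x).symm
  simp only [inner_sub_left, inner_sub_right, h1, h2 u, adjoint_apply_of_isometry hV]
  ring

theorem adjoint_apply_orthogonal (w : (LinearMap.range V.toLinearMap)ᗮ) :
    V.adjoint (w : K) = 0 := by
  refine ext_inner_left ℂ fun y => ?_
  rw [ContinuousLinearMap.adjoint_inner_right, inner_zero_right]
  exact (Submodule.mem_orthogonal _ _).1 w.2 _ ⟨y, rfl⟩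

theorem defectPart_add (hV : Isometry V) (a : K) (u : K) :
    defectPart hV (V a + u) = defectPart hV u := by
  apply Subtype.ext
  simp [defectPart, adjoint_apply_of_isometry hV]

theorem defectPart_coe (hV : Isometry V) (w : (LinearMap.range V.toLinearMap)ᗮ) :
    defectPart hV (w : K) = w := by
  apply Subtype.ext
  simp [defectPart, adjoint_apply_orthogonal]

variable {ι : Type*} (b : HilbertBasis ι ℂ (Fock (LinearMap.range V.toLinearMap)ᗮ))

/-- The image of `e(u)` under the identification of `Γ(K)` with `Γ((VK)ᗮ) ⊗ Γ(K)`, the latter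
being written as `ℓ²(ι, Γ(K))`. -/
def factorVec (hV : Isometry V) (u : K) : lp (fun _ : ι => Fock K) 2 :=
  ⟨fun i => ⟪b i, expVec (defectPart hV u)⟫_ℂ • expVec (V.adjoint u), by
    refine Memℓp.of_norm ?_
    have h := ((lp.memℓp (b.repr (expVec (defectPart hV u)))).norm).const_smul
      ‖(expVec (V.adjoint u) : Fock K)‖
    refine h.mono' fun i => le_of_eq ?_
    rw [norm_norm, norm_smul, mul_comm, ← b.repr_apply_apply, Pi.smul_apply, norm_smul,
      norm_norm, norm_norm]⟩

theorem factorVec_apply (hV : Isometry V) (u : K) (i : ι) :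
    factorVec b hV u i = ⟪b i, expVec (defectPart hV u)⟫_ℂ • expVec (V.adjoint u) := rfl

/-- Parseval's identity for `b` collapses the sum over `ι` to the kernel of the defect parts. `T =
1` yields the Gram kernel needed for `U`; general `T` yields the matrix coefficients used for
continuity. -/
theorem inner_factorVec_amp (hV : Isometry V) (T : Fock K →L[ℂ] Fock K) (u v : K) :
    ⟪factorVec b hV u, amp ι T (factorVec b hV v)⟫_ℂ =
      Complex.exp (⟪u, v⟫_ℂ - ⟪V.adjoint u, V.adjoint v⟫_ℂ) *
        ⟪expVec (V.adjoint u), T (expVec (V.adjoint v))⟫_ℂ := by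
  rw [lp.inner_eq_tsum, ← inner_defectPart hV, ← inner_expVec, ← b.tsum_inner_mul_inner,
    ← tsum_mul_right]
  refine tsum_congr fun i => ?_
  rw [amp_apply, factorVec_apply, factorVec_apply, map_smul, inner_smul_left, inner_smul_right,
    inner_conj_symm]
  ring

theorem inner_factorVec (hV : Isometry V) (u v : K) :
    ⟪factorVec b hV u, factorVec b hV v⟫_ℂ = Complex.exp ⟪u, v⟫_ℂ := by
  have h := inner_factorVec_amp b hV 1 u v
  have h1 : amp ι (1 : Fock K →L[ℂ] Fock K) (factorVec b hV v) = factorVec b hV v := by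
    ext; simp
  rw [h1, one_apply_eq_self, inner_expVec, ← Complex.exp_add] at h
  rw [h]
  congr 1
  ring

/-- Testing at `u = Va + w` with `w ⊥ VK` gives the product vectors `e(w) ⊗ e(a)`. For fixed `a` the
numbers `⟪e(a), ξ i⟫` are the coordinates of a vector of `Γ((VK)ᗮ)` orthogonal to every `e(w)`,
hence zero; letting `a` vary kills each `ξ i`. -/
theorem eq_zero_of_inner_factorVec (hV : Isometry V) (ξ : lp (fun _ : ι => Fock K) 2)
    (h : ∀ u, ⟪ξ, factorVec b hV u⟫_ℂ = 0) : ξ = 0 := by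
  ext1
  funext i
  refine eq_zero_of_inner_expVec _ fun a => ?_
  have hmem : Memℓp (fun i => ⟪expVec a, ξ i⟫_ℂ) 2 := by
    refine Memℓp.of_norm ?_
    have h := ((lp.memℓp ξ).norm).const_smul ‖(expVec a : Fock K)‖
    exact h.mono' fun i => by simpa using norm_inner_le_norm (expVec a) (ξ i)
  have hzero : b.repr.symm ⟨_, hmem⟩ = 0 := by
    refine eq_zero_of_inner_expVec _ fun w => ?_
    rw [← b.repr.inner_map_map, LinearIsometryEquiv.apply_symm_apply, lp.inner_eq_tsum,
      ← h (V a + w), lp.inner_eq_tsum]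
    refine tsum_congr fun j => ?_
    rw [factorVec_apply, defectPart_add, defectPart_coe, map_add, adjoint_apply_of_isometry hV,
      adjoint_apply_orthogonal, add_zero, inner_smul_right, b.repr_apply_apply]
    exact (RCLike.inner_apply _ _).trans (congrArg _ (inner_conj_symm _ _))
  have h0 : (⟨_, hmem⟩ : lp (fun _ : ι => ℂ) 2) = 0 := by simpa using hzero
  have h1 : ⟪expVec a, ξ i⟫_ℂ = 0 := congrArg (fun x : lp (fun _ : ι => ℂ) 2 => x i) h0
  rw [← inner_conj_symm, h1, map_zero]

/-- Equal Gram kernels give an isometry; its range is closed and has trivial orthogonal complement.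
-/
theorem exists_factorization (hV : Isometry V) :
    ∃ U : Fock K ≃ₗᵢ[ℂ] lp (fun _ : ι => Fock K) 2, ∀ u, U (expVec u) = factorVec b hV u := by
  obtain ⟨U, hU⟩ := exists_linearIsometry_expVec (factorVec b hV) (inner_factorVec b hV)
  refine ⟨LinearIsometryEquiv.ofSurjective U ?_, hU⟩
  rw [← LinearIsometry.coe_toLinearMap, ← LinearMap.range_eq_top]
  have hc : IsClosed (LinearMap.range U.toLinearMap : Set (lp (fun _ : ι => Fock K) 2)) := by
    rw [LinearMap.coe_range]
    exact U.isometry.isClosedEmbedding.isClosed_range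
  have : CompleteSpace (LinearMap.range U.toLinearMap) := hc.completeSpace_coe
  rw [← Submodule.orthogonal_eq_bot_iff, Submodule.eq_bot_iff]
  intro ξ hξ
  refine eq_zero_of_inner_factorVec b hV ξ fun u => ?_
  exact Submodule.inner_left_of_mem_orthogonal (K := LinearMap.range U.toLinearMap)
    ⟨expVec u, hU u⟩ hξ

end Factorization

/-! ### The endomorphism attached to one isometry -/

section CCREndo

/-- Conjugation of the amplification of an operator by a unitary `H ≃ ℓ²(ι, H)`. -/
def conjAmp {ι : Type*} {H : Type*} [NormedAddCommGroup H] [InnerProductSpace ℂ H]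
    [CompleteSpace H] (U : H ≃ₗᵢ[ℂ] lp (fun _ : ι => H) 2) :
    (H →L[ℂ] H) →⋆ₙₐ[ℂ] (H →L[ℂ] H) :=
  (U.symm.conjStarAlgEquiv.toStarAlgHom.comp (ampHom ι)).toNonUnitalStarAlgHom

theorem conjAmp_apply {ι : Type*} {H : Type*} [NormedAddCommGroup H] [InnerProductSpace ℂ H]
    [CompleteSpace H] (U : H ≃ₗᵢ[ℂ] lp (fun _ : ι => H) 2) (T : H →L[ℂ] H) (ξ : H) :
    conjAmp U T ξ = U.symm (amp ι T (U ξ)) := rfl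

/-- The `*`-endomorphism `W(u) ↦ W(Vu)` of `B(Γ(K))` for an isometry `V`, in the form
`T ↦ U* (⨁ T) U` with `U` unitary. -/
theorem exists_conjAmp_weyl.{u} {K : Type u} [NormedAddCommGroup K]
    [InnerProductSpace ℂ K] [CompleteSpace K] [TopologicalSpace.SeparableSpace K]
    {V : K →L[ℂ] K} (hV : Isometry V) :
    ∃ (ι : Type u) (_ : Countable ι) (U : Fock K ≃ₗᵢ[ℂ] lp (fun _ : ι => Fock K) 2),
      (∀ k, conjAmp U (weyl k) = weyl (V k)) ∧
      ∀ T u v, ⟪expVec u, conjAmp U T (expVec v)⟫_ℂ =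
        Complex.exp (⟪u, v⟫_ℂ - ⟪V.adjoint u, V.adjoint v⟫_ℂ) *
          ⟪expVec (V.adjoint u), T (expVec (V.adjoint v))⟫_ℂ := by
  obtain ⟨w, b, -⟩ := exists_hilbertBasis ℂ (Fock (LinearMap.range V.toLinearMap)ᗮ)
  obtain ⟨U, hU⟩ := exists_factorization b hV
  refine ⟨w, b.orthonormal.countable_of_separableSpace, U, fun k => ?_, fun T u v => ?_⟩
  · refine clm_ext_expVec fun v => ?_
    -- After moving `U` across, both sides are compared coordinate by coordinate: the defect part
    -- ignores `V k`, and `V*(Vk + v) = k + V*v`.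
    rw [conjAmp_apply, LinearIsometryEquiv.symm_apply_eq, weyl_expVec, map_smul, hU, hU]
    ext1
    funext i
    rw [amp_apply, factorVec_apply, map_smul, weyl_expVec, lp.coeFn_smul, Pi.smul_apply,
      factorVec_apply, defectPart_add, map_add, adjoint_apply_of_isometry hV,
      hV.norm_map_of_map_zero (map_zero V), ContinuousLinearMap.adjoint_inner_right,
      smul_comm]
  · rw [conjAmp_apply, ← U.inner_map_map, LinearIsometryEquiv.apply_symm_apply, hU, hU,
      inner_factorVec_amp]

end CCREndo

/-! ### Irreducibility of the Weyl operators -/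

section Irreducible

variable {K : Type*} [NormedAddCommGroup K] [InnerProductSpace ℂ K]

/-- A function that is both holomorphic and antiholomorphic near a point is locally constant. -/
theorem eventually_eq_const_of_analyticAt_conj {f g : ℂ → ℂ} {z₀ : ℂ} (hf : AnalyticAt ℂ f z₀)
    (hg : AnalyticAt ℂ g z₀) (hfg : ∀ z, g z = starRingEnd ℂ (f z)) :
    ∀ᶠ z in nhds z₀, f z = f z₀ := by
  obtain ⟨r, hr, h⟩ := Metric.eventually_nhds_iff_ball.1
    (hf.eventually_analyticAt.and hg.eventually_analyticAt)
  refine Metric.eventually_nhds_iff_ball.2 ⟨r, hr, fun z hz => ?_⟩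
  refine Metric.isOpen_ball.is_const_of_deriv_eq_zero (𝕜 := ℂ)
    (convex_ball z₀ r).isPreconnected
    (fun w hw => (h w hw).1.differentiableAt.differentiableWithinAt) (fun w hw => ?_) hz
    (Metric.mem_ball_self hr)
  have h1 := (h w hw).1.differentiableAt.hasDerivAt.hasFDerivAt.restrictScalars ℝ
  have h2 := (h w hw).2.differentiableAt.hasDerivAt.hasFDerivAt.restrictScalars ℝ
  have h3 := Complex.conjCLE.hasFDerivAt.comp w h1
  have h4 := h3.unique (h2.congr_of_eventuallyEq (Filter.Eventually.of_forall fun z => by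
    simp [hfg]))
  -- With `f'` and `g'` the complex derivatives, the directions `1` and `I` give `conj f' = g'` and
  -- `-I * conj f' = I * g'`, which forces `f' = 0`.
  have e1 := congrArg (fun T : ℂ →L[ℝ] ℂ => T 1) h4
  have e2 := congrArg (fun T : ℂ →L[ℝ] ℂ => T Complex.I) h4
  simp at e1 e2
  rw [← e1] at e2
  have h5 : Complex.I * starRingEnd ℂ (deriv f w) = 0 := by linear_combination (-1 / 2) * e2
  simpa using h5

/-- The coefficients of the entire function `z ↦ ⟪ξ, e(z u)⟫`. -/
def expCoeff (ξ : Fock K) (u : K) (n : ℕ) : ℂ :=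
  (Real.sqrt n.factorial : ℂ)⁻¹ * ⟪ξ n, tpow n u⟫_ℂ

theorem hasSum_expCoeff (ξ : Fock K) (u : K) (z : ℂ) :
    HasSum (fun n => z ^ n • expCoeff ξ u n) ⟪ξ, expVec (z • u)⟫_ℂ := by
  refine (lp.hasSum_inner (𝕜 := ℂ) ξ (expVec (z • u))).congr_fun fun n => ?_
  rw [expVec_apply, inner_smul_right, tpow_smul, inner_smul_right]
  simp only [expCoeff, smul_eq_mul]
  ring

theorem hasFPowerSeriesAt_inner_expVec (ξ : Fock K) (u : K) :
    HasFPowerSeriesAt (fun z : ℂ => ⟪ξ, expVec (z • u)⟫_ℂ)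
      (FormalMultilinearSeries.ofScalars ℂ (expCoeff ξ u)) 0 := by
  rw [hasFPowerSeriesAt_iff]
  refine Filter.Eventually.of_forall fun z => ?_
  simpa [FormalMultilinearSeries.coeff_ofScalars] using hasSum_expCoeff ξ u z

/-- If `u ↦ ⟪ξ, e(u)⟫` is antiholomorphic, it is constant. -/
theorem inner_expVec_eq_of_conj {ξ η : Fock K}
    (h : ∀ u, ⟪η, expVec (-u)⟫_ℂ = starRingEnd ℂ ⟪ξ, expVec u⟫_ℂ) (u : K) :
    ⟪ξ, expVec u⟫_ℂ = ⟪ξ, expVec 0⟫_ℂ := by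
  have hp := hasFPowerSeriesAt_inner_expVec ξ u
  have hc := eventually_eq_const_of_analyticAt_conj hp.analyticAt
    (hasFPowerSeriesAt_inner_expVec η (-u)).analyticAt (fun z => by rw [smul_neg, h])
  -- Constancy near `0` kills all coefficients of positive degree; since the series converges for
  -- every `z`, the value at `z = 1` is reached.
  have h1 := (hp.congr hc).eq_formalMultilinearSeries hasFPowerSeriesAt_const
  have h2 : ∀ n, n ≠ 0 → expCoeff ξ u n = 0 := by
    intro n hn
    rw [← FormalMultilinearSeries.coeff_ofScalars (𝕜 := ℂ) (p := expCoeff ξ u) (n := n), h1]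
    simp [FormalMultilinearSeries.coeff, constFormalMultilinearSeries_apply_of_nonzero hn]
  have h3 : ∀ z : ℂ, ⟪ξ, expVec (z • u)⟫_ℂ = expCoeff ξ u 0 := fun z =>
    (hasSum_expCoeff ξ u z).unique (by
      simpa using hasSum_single (f := fun n => z ^ n • expCoeff ξ u n) 0
        (fun n hn => by simp [h2 n hn]))
  have h4 := h3 1
  have h5 := h3 0
  rw [one_smul] at h4
  rw [zero_smul] at h5
  rw [h4, h5]

theorem weyl_mul_weyl_neg (u : K) : weyl u * weyl (-u) = 1 := by
  rw [weyl_mul]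
  have h0 : (⟪u, u⟫_ℂ).im = 0 := inner_self_im (𝕜 := ℂ) u
  rw [inner_neg_right, Complex.neg_im, h0, add_neg_cancel, weyl_zero]
  simp

theorem star_weyl (u : K) : star (weyl u) = weyl (-u) :=
  left_inv_eq_right_inv (Unitary.mem_iff.1 (weyl_mem_unitary u)).1 (weyl_mul_weyl_neg u)

theorem inner_weyl_left (u : K) (x y : Fock K) : ⟪weyl u x, y⟫_ℂ = ⟪x, weyl (-u) y⟫_ℂ := by
  rw [← star_weyl, ContinuousLinearMap.star_eq_adjoint, ContinuousLinearMap.adjoint_inner_right]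

theorem expVec_eq_smul_weyl (u : K) :
    expVec u = Complex.exp ((‖u‖ : ℂ) ^ 2 / 2) • weyl u (expVec 0) := by
  rw [weyl_expVec, smul_smul, ← Complex.exp_add]
  simp [neg_div]

/-- The Weyl operators act irreducibly on the Fock space. -/
theorem exists_eq_smul_one_of_commute_weyl (B : Fock K →L[ℂ] Fock K)
    (hB : ∀ u : K, Commute B (weyl u)) : ∃ c : ℂ, B = c • 1 := by
  have hB' : ∀ u ξ, B (weyl u ξ) = weyl u (B ξ) := fun u ξ =>
    congrArg (fun T : Fock K →L[ℂ] Fock K => T ξ) (hB u)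
  have h1 : ∀ u : K, ⟪B.adjoint (expVec 0), expVec (-u)⟫_ℂ =
      starRingEnd ℂ ⟪B (expVec 0), expVec u⟫_ℂ := by
    -- Writing `e(±u)` as a multiple of `W(±u) e(0)` lets `B` pass through the Weyl operator; the
    -- normalising scalars are real and equal.
    intro u
    rw [inner_conj_symm, ContinuousLinearMap.adjoint_inner_left, expVec_eq_smul_weyl (-u),
      map_smul, hB', inner_smul_right, ← inner_weyl_left, expVec_eq_smul_weyl u, inner_smul_left,
      norm_neg, ← Complex.exp_conj, map_div₀, map_pow, Complex.conj_ofReal, map_ofNat]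
  have h2 := inner_expVec_eq_of_conj h1
  refine ⟨⟪expVec 0, B (expVec 0)⟫_ℂ, clm_ext_expVec fun v => ?_⟩
  -- The pairing of a multiple of the vacuum with `e(u)` is also constant in `u`, so totality shows
  -- that the vacuum is an eigenvector of `B`. It is cyclic for the Weyl operators, whence `B` is
  -- scalar.
  have h3 : B (expVec 0) = ⟪expVec 0, B (expVec 0)⟫_ℂ • expVec 0 := by
    rw [← sub_eq_zero]
    refine eq_zero_of_inner_expVec _ fun u => ?_
    rw [inner_sub_left, h2, inner_smul_left, inner_conj_symm, inner_expVec]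
    simp
  rw [expVec_eq_smul_weyl v, map_smul, map_smul, hB']
  congr 1
  rw [_root_.smul_apply, one_apply_eq_self, ← map_smul]
  exact congrArg _ h3

end Irreducible

/-! ### Totality of the Weyl operators, by the bicommutant argument -/

section Bicommutant

variable {K : Type*} [NormedAddCommGroup K] [InnerProductSpace ℂ K]

/-- An operator on `ℓ²(ι, Γ(K))` that commutes with the amplified Weyl operators commutes with
all amplified operators. -/
theorem commute_amp_of_commute_amp_weyl {ι : Type*}
    (Q : lp (fun _ : ι => Fock K) 2 →L[ℂ] lp (fun _ : ι => Fock K) 2)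
    (hQ : ∀ (u : K) ξ, Q (amp ι (weyl u) ξ) = amp ι (weyl u) (Q ξ)) (T : Fock K →L[ℂ] Fock K)
    (ξ : lp (fun _ : ι => Fock K) 2) : Q (amp ι T ξ) = amp ι T (Q ξ) := by
  classical
  have hsingle : ∀ (S : Fock K →L[ℂ] Fock K) (j : ι) (x : Fock K),
      amp ι S (lp.single 2 j x) = lp.single 2 j (S x) := by
    intro S j x
    ext1
    funext i
    rw [amp_apply]
    by_cases h : i = j
    · subst h; simp
    · rw [lp.single_apply_ne _ _ _ h, lp.single_apply_ne _ _ _ h, map_zero]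
  have h1 : ∀ j x, Q (amp ι T (lp.single 2 j x)) = amp ι T (Q (lp.single 2 j x)) := by
    intro j x
    ext1
    funext i
    -- Each matrix block of `Q` commutes with the Weyl operators, so it is scalar and commutes with
    -- `T`.
    let B : Fock K →L[ℂ] Fock K := lp.evalCLM ℂ (fun _ : ι => Fock K) 2 i ∘L Q ∘L
      lp.singleContinuousLinearMap ℂ (fun _ : ι => Fock K) 2 j
    have hB : ∀ y, B y = Q (lp.single 2 j y) i := fun y => rfl
    obtain ⟨c, hc⟩ := exists_eq_smul_one_of_commute_weyl B fun u => by
      ext1 y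
      change B (weyl u y) = weyl u (B y)
      rw [hB, hB, ← hsingle, hQ, amp_apply]
    rw [hsingle, amp_apply, ← hB, ← hB, hc]
    simp
  have h2 := lp.hasSum_single (p := 2) (by norm_num) ξ
  have h3 := h2.mapL (Q ∘L amp ι T)
  have h4 := h2.mapL (amp ι T ∘L Q)
  refine h3.unique (h4.congr_fun fun i => ?_)
  exact h1 _ _

theorem mapsTo_orthogonal_of_mapsTo_adjoint {E : Type*} [NormedAddCommGroup E]
    [InnerProductSpace ℂ E] [CompleteSpace E] (S : Submodule ℂ E) (A : E →L[ℂ] E)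
    (h : ∀ ξ ∈ S, A.adjoint ξ ∈ S) : ∀ ξ ∈ Sᗮ, A ξ ∈ Sᗮ := by
  intro ξ hξ
  rw [Submodule.mem_orthogonal]
  intro η hη
  rw [← ContinuousLinearMap.adjoint_inner_left]
  exact (Submodule.mem_orthogonal S ξ).1 hξ _ (h η hη)

/-- The projection onto the orthogonal complement of a reducing subspace commutes with the
operator. -/
theorem starProjection_orthogonal_map_of_invariant {E : Type*} [NormedAddCommGroup E]
    [InnerProductSpace ℂ E] [CompleteSpace E] (S : Submodule ℂ E) (A : E →L[ℂ] E)
    (h : ∀ ξ ∈ S, A ξ ∈ S) (h' : ∀ ξ ∈ S, A.adjoint ξ ∈ S) (ξ : E) :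
    Sᗮ.starProjection (A ξ) = A (Sᗮ.starProjection ξ) := by
  have m0 := mapsTo_orthogonal_of_mapsTo_adjoint S A h'
  have m1 := mapsTo_orthogonal_of_mapsTo_adjoint S A.adjoint
    (by rwa [ContinuousLinearMap.adjoint_adjoint])
  have m2 : A ξ - A (Sᗮ.starProjection ξ) ∈ Sᗮᗮ := by
    rw [← map_sub]
    exact mapsTo_orthogonal_of_mapsTo_adjoint Sᗮ A m1 _
      (Submodule.sub_starProjection_mem_orthogonal ξ)
  exact Submodule.eq_starProjection_of_mem_orthogonal
    (m0 _ (Submodule.starProjection_apply_mem Sᗮ ξ)) m2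

theorem adjoint_amp_weyl (ι : Type*) (u : K) :
    ContinuousLinearMap.adjoint (amp ι (weyl u)) = amp ι (weyl (-u)) := by
  rw [← star_weyl, ← ContinuousLinearMap.star_eq_adjoint]
  exact ((ampHom ι).map_star' (weyl u)).symm

theorem amp_weyl_amp_weyl {ι : Type*} (u v : K) (η : lp (fun _ : ι => Fock K) 2) :
    amp ι (weyl u) (amp ι (weyl v) η) =
      Complex.exp (-((⟪u, v⟫_ℂ).im : ℂ) * Complex.I) • amp ι (weyl (u + v)) η := by
  ext1
  funext i
  exact congrArg (fun T : Fock K →L[ℂ] Fock K => T (η i)) (weyl_mul u v)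

theorem amp_weyl_zero {ι : Type*} (η : lp (fun _ : ι => Fock K) 2) :
    amp ι (weyl (0 : K)) η = η := by
  ext1
  funext i
  rw [amp_apply, weyl_zero]
  rfl

/-- A form of von Neumann's bicommutant theorem: if `ζ` is orthogonal to the cyclic subspace
generated from `η` by a selfadjoint family `A` of operators closed under multiplication up to
scalars, it is orthogonal to `T η` for all `T` in the bicommutant of `A`. -/
theorem inner_eq_zero_of_bicommutant {E U : Type*} [NormedAddCommGroup E]
    [InnerProductSpace ℂ E] [CompleteSpace E] (A : U → E →L[ℂ] E)
    (hadj : ∀ u, ∃ v, (A u).adjoint = A v)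
    (hmul : ∀ u v ξ, ∃ (c : ℂ) (w : U), A u (A v ξ) = c • A w ξ)
    (hone : ∃ u, ∀ ξ, A u ξ = ξ) (T : E →L[ℂ] E)
    (hT : ∀ Q : E →L[ℂ] E, (∀ u ξ, Q (A u ξ) = A u (Q ξ)) → ∀ ξ, Q (T ξ) = T (Q ξ))
    (ζ η : E) (h : ∀ u, ⟪ζ, A u η⟫_ℂ = 0) : ⟪ζ, T η⟫_ℂ = 0 := by
  let S := Submodule.span ℂ (Set.range fun u => A u η)
  have hS : ∀ u, ∀ ξ ∈ S, A u ξ ∈ S := by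
    intro u
    change S ≤ S.comap (A u).toLinearMap
    rw [Submodule.span_le]
    rintro _ ⟨v, rfl⟩
    obtain ⟨c, w, e⟩ := hmul u v η
    change A u (A v η) ∈ S
    rw [e]
    exact S.smul_mem _ (Submodule.subset_span ⟨_, rfl⟩)
  -- The projection onto `Sᗮ` lies in the commutant, so it commutes with `T`; it fixes `ζ` and kills
  -- `η`. Working with `Sᗮ` avoids passing to the closure of `S`.
  have hcomm : ∀ u ξ, Sᗮ.starProjection (A u ξ) = A u (Sᗮ.starProjection ξ) := by
    intro u ξ
    obtain ⟨v, hv⟩ := hadj u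
    exact starProjection_orthogonal_map_of_invariant S (A u) (hS u) (by rw [hv]; exact hS v) ξ
  have hη : Sᗮ.starProjection η = 0 := by
    obtain ⟨u, hu⟩ := hone
    rw [Submodule.starProjection_apply_eq_zero_iff]
    exact Submodule.le_orthogonal_orthogonal S (Submodule.subset_span ⟨u, hu η⟩)
  have hζ : Sᗮ.starProjection ζ = ζ := by
    rw [Submodule.starProjection_eq_self_iff, Submodule.mem_orthogonal']
    intro x hx
    induction hx using Submodule.span_induction with
    | mem x hx => obtain ⟨u, rfl⟩ := hx; exact h u
    | zero => exact inner_zero_right _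
    | add x y _ _ hx hy => rw [inner_add_right, hx, hy, add_zero]
    | smul c x _ hx => rw [inner_smul_right, hx, mul_zero]
  rw [← hζ, Submodule.inner_starProjection_left_eq_right, hT _ hcomm, hη, map_zero,
    inner_zero_right]

/-- The Weyl operators are total for the predual of `B(Γ(K))`. -/
theorem inner_amp_eq_zero {ι : Type*} (ζ η : lp (fun _ : ι => Fock K) 2)
    (h : ∀ u : K, ⟪ζ, amp ι (weyl u) η⟫_ℂ = 0) (T : Fock K →L[ℂ] Fock K) :
    ⟪ζ, amp ι T η⟫_ℂ = 0 :=
  inner_eq_zero_of_bicommutant (fun u : K => amp ι (weyl u))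
    (fun u => ⟨-u, adjoint_amp_weyl ι u⟩) (fun u v ξ => ⟨_, _, amp_weyl_amp_weyl u v ξ⟩)
    ⟨0, amp_weyl_zero⟩ (amp ι T) (fun Q hQ => commute_amp_of_commute_amp_weyl Q hQ T) ζ η h

end Bicommutant

/-! ### Normal functionals and normal endomorphisms -/

section NormalFunctional

variable {H : Type*} [NormedAddCommGroup H] [InnerProductSpace ℂ H]

theorem memℓp_two_iff {ι : Type*} {E : ι → Type*} [∀ i, NormedAddCommGroup (E i)]
    {f : ∀ i, E i} : Memℓp f 2 ↔ Summable fun i => ‖f i‖ ^ 2 := by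
  rw [memℓp_gen_iff (by norm_num)]
  simp

theorem summable_norm_sq {ι : Type*} {E : ι → Type*} [∀ i, NormedAddCommGroup (E i)]
    (f : lp E 2) : Summable fun i => ‖f i‖ ^ 2 :=
  memℓp_two_iff.1 (lp.memℓp f)

/-- Extension by zero along an injection `ι → ℕ`. This frees the choice of index set: `Unit` for
matrix coefficients, `ℕ ⊕ ℕ` for sums, `ℕ × ι` for composition with `conjAmp`. -/
theorem isNormalFunctional_of_countable {ι : Type*} [Countable ι] (ξ η : lp (fun _ : ι => H) 2)
    (ρ : (H →L[ℂ] H) →ₗ[ℂ] ℂ) (h : ∀ T, ρ T = ⟪ξ, amp ι T η⟫_ℂ) : IsNormalFunctional ρ := by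
  obtain ⟨f, hf⟩ := exists_injective_nat ι
  have hmem : ∀ ζ : lp (fun _ : ι => H) 2, Memℓp (Function.extend f ζ (0 : ℕ → H)) 2 := by
    intro ζ
    rw [memℓp_two_iff, ← hf.summable_iff]
    · refine (summable_norm_sq ζ).congr fun i => ?_
      simp [hf.extend_apply]
    · intro n hn
      rw [Function.extend_apply' _ _ _ (by simpa using hn)]
      simp
  refine ⟨⟨_, hmem ξ⟩, ⟨_, hmem η⟩, fun T => ?_⟩
  change _ = ∑' n, ⟪Function.extend f ξ 0 n, T (Function.extend f η 0 n)⟫_ℂ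
  rw [h, lp.inner_eq_tsum, ← hf.tsum_eq]
  · refine tsum_congr fun i => ?_
    rw [hf.extend_apply, hf.extend_apply, amp_apply]
  · intro n hn
    by_contra hn'
    refine hn ?_
    change ⟪Function.extend f ξ 0 n, T (Function.extend f η 0 n)⟫_ℂ = 0
    rw [Function.extend_apply' _ _ _ (by simpa using hn')]
    simp

theorem isNormalFunctional_iff {ρ : (H →L[ℂ] H) →ₗ[ℂ] ℂ} :
    IsNormalFunctional ρ ↔ ∃ ξ η : lp (fun _ : ℕ => H) 2, ∀ T, ρ T = ⟪ξ, amp ℕ T η⟫_ℂ :=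
  exists_congr fun ξ => exists_congr fun η => forall_congr' fun T => by
    rw [lp.inner_eq_tsum]
    rfl

theorem isNormalFunctional_zero : IsNormalFunctional (0 : (H →L[ℂ] H) →ₗ[ℂ] ℂ) :=
  ⟨0, 0, fun T => by simp⟩

theorem IsNormalFunctional.smul {ρ : (H →L[ℂ] H) →ₗ[ℂ] ℂ} (hρ : IsNormalFunctional ρ) (c : ℂ) :
    IsNormalFunctional (c • ρ) := by
  obtain ⟨ξ, η, h⟩ := isNormalFunctional_iff.1 hρ
  exact isNormalFunctional_iff.2 ⟨ξ, c • η, fun T => by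
    rw [map_smul, inner_smul_right, ← h]; rfl⟩

theorem IsNormalFunctional.add {ρ σ : (H →L[ℂ] H) →ₗ[ℂ] ℂ} (hρ : IsNormalFunctional ρ)
    (hσ : IsNormalFunctional σ) : IsNormalFunctional (ρ + σ) := by
  obtain ⟨ξ, η, h⟩ := isNormalFunctional_iff.1 hρ
  obtain ⟨ξ', η', h'⟩ := isNormalFunctional_iff.1 hσ
  have hmem : ∀ ζ ζ' : lp (fun _ : ℕ => H) 2,
      Memℓp (Sum.elim ζ ζ' : ℕ ⊕ ℕ → H) 2 := fun ζ ζ' =>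
    memℓp_two_iff.2 (Summable.sum _ (summable_norm_sq ζ) (summable_norm_sq ζ'))
  refine isNormalFunctional_of_countable (ι := ℕ ⊕ ℕ) ⟨_, hmem ξ ξ'⟩ ⟨_, hmem η η'⟩ _
    fun T => ?_
  have hs : HasSum (fun i : ℕ ⊕ ℕ => ⟪(Sum.elim ξ ξ' i : H), T (Sum.elim η η' i)⟫_ℂ)
      (⟪ξ, amp ℕ T η⟫_ℂ + ⟪ξ', amp ℕ T η'⟫_ℂ) :=
    HasSum.sum (lp.hasSum_inner (𝕜 := ℂ) ξ (amp ℕ T η))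
      (lp.hasSum_inner (𝕜 := ℂ) ξ' (amp ℕ T η'))
  rw [LinearMap.add_apply, h, h', ← hs.tsum_eq, lp.inner_eq_tsum]
  rfl

/-- A functional continuous for the weak topology of a family lies in the span of that family, and
the normal functionals are already closed under sums and multiples. -/
theorem isNormalFunctional_of_continuous {φ : (H →L[ℂ] H) →ₗ[ℂ] ℂ}
    (h : @Continuous _ _ (sigmaWeak H) _ φ) : IsNormalFunctional φ := by
  have h1 := (LinearMap.mem_span_iff_continuous
    (f := fun ρ : {ρ : (H →L[ℂ] H) →ₗ[ℂ] ℂ // IsNormalFunctional ρ} => ρ.1) φ).2 h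
  refine Submodule.span_induction (p := fun ρ _ => IsNormalFunctional ρ) ?_
    isNormalFunctional_zero (fun _ _ _ _ hρ hσ => hρ.add hσ) (fun c _ _ hρ => hρ.smul c) h1
  rintro _ ⟨ρ, rfl⟩
  exact ρ.2

theorem IsNormalFunctional.continuous {ρ : (H →L[ℂ] H) →ₗ[ℂ] ℂ} (h : IsNormalFunctional ρ) :
    @Continuous _ _ (sigmaWeak H) _ ρ :=
  continuous_iInf_dom (i := ⟨ρ, h⟩) continuous_induced_dom

/-- The matrix coefficient `T ↦ ⟪ξ, T η⟫`. -/
def coeffFunctional (ξ η : H) : (H →L[ℂ] H) →ₗ[ℂ] ℂ :=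
  (innerSL ℂ ξ).toLinearMap ∘ₗ (ContinuousLinearMap.apply ℂ H η).toLinearMap

theorem isNormalFunctional_coeffFunctional (ξ η : H) :
    IsNormalFunctional (coeffFunctional ξ η) := by
  refine isNormalFunctional_of_countable (ι := Unit) (lp.single 2 () ξ) (lp.single 2 () η) _
    fun T => ?_
  rw [lp.inner_single_left]
  simp [coeffFunctional]

variable [CompleteSpace H]

/-- The composite `ρ ∘ φ` of a functional with an endomorphism. -/
def pullback (φ : (H →L[ℂ] H) →⋆ₙₐ[ℂ] (H →L[ℂ] H)) (ρ : (H →L[ℂ] H) →ₗ[ℂ] ℂ) :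
    (H →L[ℂ] H) →ₗ[ℂ] ℂ where
  toFun T := ρ (φ T)
  map_add' S T := by rw [map_add, map_add]
  map_smul' c T := by rw [map_smul, map_smul]; rfl

theorem IsNormalFunctional.pullback {ρ : (H →L[ℂ] H) →ₗ[ℂ] ℂ} (hρ : IsNormalFunctional ρ)
    {φ : (H →L[ℂ] H) →⋆ₙₐ[ℂ] (H →L[ℂ] H)} (hφ : IsNormalEndo φ) :
    IsNormalFunctional (pullback φ ρ) :=
  isNormalFunctional_of_continuous
    (@Continuous.comp _ _ _ (sigmaWeak H) (sigmaWeak H) _ φ ρ hρ.continuous hφ)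

/-- Expanding in the coordinates of `U` turns `∑ₙ ⟪ξₙ, U*(amp T)U ηₙ⟫` into `∑ₙᵢ ⟪(Uξₙ)ᵢ, T
(Uηₙ)ᵢ⟫`; both double families are square summable because `U` preserves norms. -/
theorem isNormalEndo_conjAmp {ι : Type*} [Countable ι] (U : H ≃ₗᵢ[ℂ] lp (fun _ : ι => H) 2) :
    IsNormalEndo (conjAmp U) := by
  refine continuous_iInf_rng.2 fun ⟨ρ, hρ⟩ => continuous_induced_rng.2 ?_
  obtain ⟨ξ, η, h⟩ := hρ
  have hU : ∀ x, Summable fun i => ‖U x i‖ ^ 2 := fun x => summable_norm_sq (U x)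
  have hUs : ∀ x, ∑' i, ‖U x i‖ ^ 2 = ‖x‖ ^ 2 := by
    intro x
    have := lp.norm_rpow_eq_tsum (p := 2) (by norm_num) (U x)
    simp only [ENNReal.toReal_ofNat, Real.rpow_ofNat] at this
    rw [← this, U.norm_map]
  have hmem : ∀ ζ : lp (fun _ : ℕ => H) 2, Memℓp (fun p : ℕ × ι => U (ζ p.1) p.2) 2 := by
    intro ζ
    rw [memℓp_two_iff, summable_prod_of_nonneg (fun p => by positivity)]
    refine ⟨fun n => hU (ζ n), (summable_norm_sq ζ).congr fun n => (hUs _).symm⟩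
  refine IsNormalFunctional.continuous (ρ := CCR.pullback (conjAmp U) ρ) ?_
  refine isNormalFunctional_of_countable (ι := ℕ × ι) ⟨_, hmem ξ⟩ ⟨_, hmem η⟩ _ fun T => ?_
  rw [lp.inner_eq_tsum, (lp.summable_inner (𝕜 := ℂ) _ _).tsum_prod]
  refine (h _).trans (tsum_congr fun n => ?_)
  rw [conjAmp_apply, ← U.inner_map_map, LinearIsometryEquiv.apply_symm_apply, lp.inner_eq_tsum]
  rfl

end NormalFunctional

/-- A normal endomorphism of `B(Γ(K))` is determined by its values on the Weyl operators. -/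
theorem isNormalEndo_ext {K : Type*} [NormedAddCommGroup K] [InnerProductSpace ℂ K]
    {φ ψ : (Fock K →L[ℂ] Fock K) →⋆ₙₐ[ℂ] (Fock K →L[ℂ] Fock K)}
    (hφ : IsNormalEndo φ) (hψ : IsNormalEndo ψ) (h : ∀ u : K, φ (weyl u) = ψ (weyl u)) :
    φ = ψ := by
  refine NonUnitalStarAlgHom.ext fun T => ContinuousLinearMap.ext fun x => ?_
  refine ext_inner_left ℂ fun y => ?_
  have hρ := isNormalFunctional_coeffFunctional y x
  -- The difference of the two pulled-back matrix coefficients is normal and vanishes on every Weyl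
  -- operator.
  obtain ⟨ζ, η, hζ⟩ := isNormalFunctional_iff.1
    ((hρ.pullback hφ).add ((hρ.pullback hψ).smul (-1)))
  have h1 := inner_amp_eq_zero ζ η (fun u => by
    rw [← hζ]
    change coeffFunctional y x (φ (weyl u)) + (-1 : ℂ) • coeffFunctional y x (ψ (weyl u)) = 0
    rw [h]
    simp) T
  rw [← hζ] at h1
  change ⟪y, φ T x⟫_ℂ + (-1 : ℂ) • ⟪y, ψ T x⟫_ℂ = 0 at h1
  rw [neg_smul, one_smul, ← sub_eq_add_neg, sub_eq_zero] at h1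
  exact h1

/-! ### Strong continuity of the adjoints over a spanning cone -/

section Cone

variable {d : ℕ} {P : ProperCone ℝ (EuclideanSpace ℝ (Fin d))}

/-- For a spanning cone, the decomposition of a vector as a difference of elements of the cone
can be chosen continuously, with `0 = 0 - 0`. -/
theorem exists_continuous_sub_eq
    (hspan : ∀ z : EuclideanSpace ℝ (Fin d), ∃ x ∈ P, ∃ y ∈ P, z = x - y) :
    ∃ p q : EuclideanSpace ℝ (Fin d) → P, Continuous p ∧ Continuous q ∧ p 0 = 0 ∧ q 0 = 0 ∧
      ∀ z, z = (p z : EuclideanSpace ℝ (Fin d)) - q z := by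
  choose a ha b hb hab using fun i : Fin d => hspan (EuclideanSpace.single i 1)
  have hmem : ∀ (a b : Fin d → EuclideanSpace ℝ (Fin d)), (∀ i, a i ∈ P) → (∀ i, b i ∈ P) →
      ∀ z : EuclideanSpace ℝ (Fin d), ∑ i, (max (z i) 0 • a i + max (-z i) 0 • b i) ∈ P := by
    intro a b ha hb z
    exact Submodule.sum_mem P.toSubmodule fun i _ => Submodule.add_mem P.toSubmodule
      (P.toSubmodule.smul_mem (⟨max (z i) 0, le_max_right _ _⟩ : NNReal) (ha i))
      (P.toSubmodule.smul_mem (⟨max (-z i) 0, le_max_right _ _⟩ : NNReal) (hb i))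
  -- With `eᵢ = aᵢ - bᵢ`, take `p z = ∑ (zᵢ⁺ aᵢ + zᵢ⁻ bᵢ)` and swap `a` and `b` for `q z`;
  -- nonnegative coefficients keep both in the cone.
  refine ⟨fun z => ⟨_, hmem a b ha hb z⟩, fun z => ⟨_, hmem b a hb ha z⟩,
    Continuous.subtype_mk (by fun_prop) _, Continuous.subtype_mk (by fun_prop) _,
    Subtype.ext (by simp), Subtype.ext (by simp), fun z => ?_⟩
  change z = ∑ i, _ - ∑ i, _
  rw [← Finset.sum_sub_distrib]
  have h : ∀ i, max (z i) 0 • a i + max (-z i) 0 • b i - (max (z i) 0 • b i + max (-z i) 0 • a i) =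
      z i • EuclideanSpace.single i (1 : ℝ) := by
    intro i
    have e : z i = max (z i) 0 - max (-z i) 0 := by
      rcases le_total (z i) 0 with h | h
      · rw [max_eq_right h, max_eq_left (by linarith)]; ring
      · rw [max_eq_left h, max_eq_right (by linarith)]; ring
    conv_rhs => rw [hab i, e]
    module
  simp only [h]
  ext j
  simp [Finset.sum_apply, Pi.single_apply]

variable {K : Type*} [NormedAddCommGroup K] [InnerProductSpace ℂ K]
  {V : P → K →L[ℂ] K}

theorem IsIsometricRep.map_zero (hV : IsIsometricRep P V) (u : K) : V 0 u = u := by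
  have h := congrArg (fun T : K →L[ℂ] K => T u) (hV.map_add 0 0)
  simp only [add_zero] at h
  exact ((hV.isometry 0).injective h).symm

variable [CompleteSpace K]

/-- Since `V_{x+h}* = V_x* V_h*` and adjoints of isometries are contractions, the left side is at
most `‖V_h* u - u‖ = ‖V_h*(u - V_h u)‖`. -/
theorem IsIsometricRep.norm_adjoint_add_sub_le (hV : IsIsometricRep P V) (x h : P) (u : K) :
    ‖(V (x + h)).adjoint u - (V x).adjoint u‖ ≤ ‖V h u - u‖ := by
  have e : (V (x + h)).adjoint u = (V x).adjoint ((V h).adjoint u) := by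
    rw [add_comm, hV.map_add, ContinuousLinearMap.adjoint_comp]
    rfl
  have hle : ∀ (y : P) (v : K), ‖(V y).adjoint v‖ ≤ ‖v‖ := by
    intro y v
    refine ((V y).adjoint.le_opNorm v).trans ?_
    rw [LinearIsometryEquiv.norm_map]
    refine mul_le_of_le_one_left (norm_nonneg v) ?_
    refine (V y).opNorm_le_bound zero_le_one fun z => ?_
    rw [(hV.isometry y).norm_map_of_map_zero (_root_.map_zero _), one_mul]
  rw [e, ← map_sub]
  refine (hle x _).trans ?_
  conv_lhs => rw [← adjoint_apply_of_isometry (hV.isometry h) u, ← map_sub]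
  rw [adjoint_apply_of_isometry (hV.isometry h), ← norm_neg, ← map_neg, neg_sub]
  exact hle h _

/-- Write `y - x = p - q` with `p`, `q` in the cone tending to `0` as `y → x`. Both `V_x* u` and
`V_y* u` are then close to the adjoint at the common point `x + p = y + q`. -/
theorem IsIsometricRep.continuous_adjoint (hV : IsIsometricRep P V)
    (hspan : ∀ z : EuclideanSpace ℝ (Fin d), ∃ x ∈ P, ∃ y ∈ P, z = x - y) (u : K) :
    Continuous fun x => (V x).adjoint u := by
  obtain ⟨p, q, hp, hq, hp0, hq0, hpq⟩ := exists_continuous_sub_eq hspan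
  rw [continuous_iff_continuousAt]
  intro x
  rw [ContinuousAt, tendsto_iff_norm_sub_tendsto_zero]
  let δ : P → EuclideanSpace ℝ (Fin d) := fun y => (y : EuclideanSpace ℝ (Fin d)) - x
  have hδ : Continuous δ := by fun_prop
  have hbound : ∀ y : P, ‖(V y).adjoint u - (V x).adjoint u‖ ≤
      ‖V (q (δ y)) u - u‖ + ‖V (p (δ y)) u - u‖ := by
    intro y
    have e : x + p (δ y) = y + q (δ y) := by
      apply Subtype.ext
      have h : (y : EuclideanSpace ℝ (Fin d)) - x = _ := hpq (δ y)
      rw [sub_eq_iff_eq_add] at h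
      change (x : EuclideanSpace ℝ (Fin d)) + p (δ y) = y + q (δ y)
      conv_rhs => rw [h]
      abel
    have h1 := hV.norm_adjoint_add_sub_le y (q (δ y)) u
    have h2 := hV.norm_adjoint_add_sub_le x (p (δ y)) u
    rw [e] at h2
    rw [norm_sub_rev] at h1
    exact (norm_sub_le_norm_sub_add_norm_sub _ _ _).trans (add_le_add h1 h2)
  have hcont : Continuous fun y : P => ‖V (q (δ y)) u - u‖ + ‖V (p (δ y)) u - u‖ := by
    have h1 := (hV.continuous u).comp (hq.comp hδ)
    have h2 := (hV.continuous u).comp (hp.comp hδ)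
    exact (h1.sub continuous_const).norm.add (h2.sub continuous_const).norm
  have hlim := hcont.tendsto x
  have hδx : δ x = 0 := sub_self _
  simp only [hδx, hp0, hq0, hV.map_zero, sub_self, norm_zero, add_zero] at hlim
  exact squeeze_zero (fun y => norm_nonneg _) hbound hlim

end Cone

/-! ### From exponential vectors to the whole predual -/

section WeakContinuity

theorem IsNormalEndo.comp {H : Type*} [NormedAddCommGroup H] [InnerProductSpace ℂ H]
    [CompleteSpace H] {φ ψ : (H →L[ℂ] H) →⋆ₙₐ[ℂ] (H →L[ℂ] H)} (hφ : IsNormalEndo φ)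
    (hψ : IsNormalEndo ψ) : IsNormalEndo (φ.comp ψ) :=
  @Continuous.comp _ _ _ (sigmaWeak H) (sigmaWeak H) (sigmaWeak H) ψ φ hφ hψ

theorem norm_conjAmp_apply_le {ι : Type*} {H : Type*} [NormedAddCommGroup H]
    [InnerProductSpace ℂ H] [CompleteSpace H] (U : H ≃ₗᵢ[ℂ] lp (fun _ : ι => H) 2)
    (T : H →L[ℂ] H) : ‖conjAmp U T‖ ≤ ‖T‖ := by
  refine ContinuousLinearMap.opNorm_le_bound _ (norm_nonneg T) fun ξ => ?_
  have h := (amp ι T).le_of_opNorm_le (LinearMap.mkContinuous_norm_le _ (norm_nonneg T) _) (U ξ)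
  rwa [conjAmp_apply, LinearIsometryEquiv.norm_map, ← U.norm_map ξ]

/-- A uniformly Lipschitz family of functions depends continuously on the parameter as soon as
it does so at the points of a dense set. -/
theorem continuous_of_dense_of_lipschitz {E X : Type*} [NormedAddCommGroup E]
    [TopologicalSpace X] {S : Set E} (hS : Dense S) (f : E → X → ℂ) (C : ℝ)
    (hf : ∀ a b x, ‖f a x - f b x‖ ≤ C * ‖a - b‖) (h : ∀ a ∈ S, Continuous (f a)) (a : E) :
    Continuous (f a) := by
  refine continuous_of_uniform_approx_of_continuous fun u hu => ?_
  obtain ⟨ε, hε, hεu⟩ := Metric.mem_uniformity_dist.1 hu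
  -- The denominator `|C| + 1` is positive for every real `C`.
  obtain ⟨b, hb, hab⟩ := hS.exists_dist_lt a (ε := ε / (|C| + 1)) (by positivity)
  refine ⟨f b, h b hb, fun x => hεu ?_⟩
  rw [dist_eq_norm] at hab ⊢
  rw [lt_div_iff₀ (by positivity)] at hab
  have h1 := hf a b x
  have h2 : C * ‖a - b‖ ≤ |C| * ‖a - b‖ :=
    mul_le_mul_of_nonneg_right (le_abs_self C) (norm_nonneg _)
  nlinarith [norm_nonneg (a - b)]

/-- The uniform bound makes the coefficients Lipschitz in each vector, so the density argument
applies first in `η`, then in `ξ`. -/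
theorem continuous_inner_of_continuous_inner_expVec {K X : Type*} [NormedAddCommGroup K]
    [InnerProductSpace ℂ K] [TopologicalSpace X] (A : X → Fock K →L[ℂ] Fock K) (C : ℝ)
    (hA : ∀ x, ‖A x‖ ≤ C)
    (h : ∀ u v : K, Continuous fun x => ⟪expVec u, A x (expVec v)⟫_ℂ) (ξ η : Fock K) :
    Continuous fun x => ⟪ξ, A x η⟫_ℂ := by
  have hb : ∀ ξ η x, ‖⟪ξ, A x η⟫_ℂ‖ ≤ C * ‖ξ‖ * ‖η‖ := by
    intro ξ η x
    have h1 := norm_inner_le_norm (𝕜 := ℂ) ξ (A x η)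
    have h2 := (A x).le_of_opNorm_le (hA x) η
    have h3 := mul_le_mul_of_nonneg_left h2 (norm_nonneg ξ)
    linarith
  have h1 : ∀ (u : K) (η : Fock K), Continuous fun x => ⟪expVec u, A x η⟫_ℂ := by
    intro u
    refine continuous_of_dense_of_lipschitz dense_span_range_expVec _ (C * ‖(expVec u : Fock K)‖)
      (fun a b x => by rw [← inner_sub_right, ← map_sub]; exact hb _ _ _) fun a ha => ?_
    induction ha using Submodule.span_induction with
    | mem x hx => obtain ⟨v, rfl⟩ := hx; exact h u v
    | zero => simpa using continuous_const
    | add x y _ _ hx hy => simp only [map_add, inner_add_right]; exact hx.add hy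
    | smul c x _ hx => simpa [inner_smul_right] using hx.const_mul c
  refine continuous_of_dense_of_lipschitz dense_span_range_expVec (fun ξ x => ⟪ξ, A x η⟫_ℂ)
    (C * ‖η‖) (fun a b x => by
      rw [← inner_sub_left]; exact (hb _ _ _).trans (le_of_eq (by ring))) (fun a ha => ?_) ξ
  induction ha using Submodule.span_induction with
  | mem x hx => obtain ⟨v, rfl⟩ := hx; exact h1 v η
  | zero => simpa using continuous_const
  | add x y _ _ hx hy => simp only [inner_add_left]; exact hx.add hy
  | smul c x _ hx => simp only [inner_smul_left]; exact hx.const_mul _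

/-- The Weierstrass M-test: the series defining `ρ` converges uniformly on norm-bounded sets. -/
theorem IsNormalFunctional.continuous_comp {H X : Type*} [NormedAddCommGroup H]
    [InnerProductSpace ℂ H] [TopologicalSpace X] {ρ : (H →L[ℂ] H) →ₗ[ℂ] ℂ}
    (hρ : IsNormalFunctional ρ) (A : X → H →L[ℂ] H) (C : ℝ) (hA : ∀ x, ‖A x‖ ≤ C)
    (h : ∀ ξ η, Continuous fun x => ⟪ξ, A x η⟫_ℂ) : Continuous fun x => ρ (A x) := by
  obtain ⟨ξ, η, hρ⟩ := hρ
  simp only [hρ]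
  refine continuous_tsum (u := fun n => |C| * (‖ξ n‖ ^ 2 + ‖η n‖ ^ 2)) (fun n => h _ _)
    (((summable_norm_sq ξ).add (summable_norm_sq η)).mul_left _) fun n x => ?_
  have h1 := norm_inner_le_norm (𝕜 := ℂ) (ξ n) (A x (η n))
  have h2 := (A x).le_of_opNorm_le ((hA x).trans (le_abs_self C)) (η n)
  have h3 := mul_le_mul_of_nonneg_left h2 (norm_nonneg (ξ n))
  have h4 : ‖ξ n‖ * ‖η n‖ ≤ ‖ξ n‖ ^ 2 + ‖η n‖ ^ 2 := by
    nlinarith [sq_nonneg (‖ξ n‖ - ‖η n‖), sq_nonneg ‖ξ n‖, sq_nonneg ‖η n‖]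
  have h5 := mul_le_mul_of_nonneg_left h4 (abs_nonneg C)
  linarith

end WeakContinuity

end CCR

end

/-! ### Existence and uniqueness of the CCR flow -/

theorem mainTheorem10 {d : ℕ} (P : ProperCone ℝ (EuclideanSpace ℝ (Fin d)))
    (hspan : ∀ z : EuclideanSpace ℝ (Fin d), ∃ x ∈ P, ∃ y ∈ P, z = x - y)
    (hpointed : ∀ x ∈ P, -x ∈ P → x = 0)
    {K : Type*} [NormedAddCommGroup K] [InnerProductSpace ℂ K] [CompleteSpace K]
    [TopologicalSpace.SeparableSpace K]
    (V : P → K →L[ℂ] K) (hV : CCR.IsIsometricRep P V) :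
    ∃! α : P → (CCR.Fock K →L[ℂ] CCR.Fock K) →⋆ₙₐ[ℂ] (CCR.Fock K →L[ℂ] CCR.Fock K),
      CCR.IsE0Semigroup P α ∧
        ∀ (x : P) (u : K), α x (CCR.weyl u) = CCR.weyl (V x u) := by
  choose ι hι U hweyl hinner using fun x => CCR.exists_conjAmp_weyl (hV.isometry x)
  have hnormal : ∀ x, CCR.IsNormalEndo (CCR.conjAmp (U x)) := fun x =>
    CCR.isNormalEndo_conjAmp (U x)
  refine ⟨fun x => CCR.conjAmp (U x), ⟨⟨⟨hnormal, ?_, ?_, ?_⟩, ?_⟩, hweyl⟩, ?_⟩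
  · intro T
    -- The unitaries `U x` are chosen independently for each `x`, so the semigroup identities come
    -- from comparing normal endomorphisms on Weyl operators.
    have h : CCR.conjAmp (U 0) = NonUnitalStarAlgHom.id ℂ _ :=
      CCR.isNormalEndo_ext (hnormal 0) (@continuous_id _ (CCR.sigmaWeak _)) fun u => by
        rw [hweyl, hV.map_zero]
        rfl
    exact DFunLike.congr_fun h T
  · intro x y T
    have h : CCR.conjAmp (U (x + y)) = (CCR.conjAmp (U x)).comp (CCR.conjAmp (U y)) :=
      CCR.isNormalEndo_ext (hnormal _) ((hnormal x).comp (hnormal y)) fun u => by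
          rw [NonUnitalStarAlgHom.comp_apply, hweyl, hweyl, hweyl, hV.map_add]
          rfl
    exact DFunLike.congr_fun h T
  · intro ρ hρ T
    refine hρ.continuous_comp _ ‖T‖ (fun x => CCR.norm_conjAmp_apply_le (U x) T) ?_
    refine CCR.continuous_inner_of_continuous_inner_expVec _ ‖T‖
      (fun x => CCR.norm_conjAmp_apply_le (U x) T) fun u v => ?_
    -- The explicit coefficients involve `x` only through the adjoints applied to `u` and `v`.
    simp only [hinner]
    have hu := hV.continuous_adjoint hspan u
    have hv := hV.continuous_adjoint hspan v
    exact (Complex.continuous_exp.comp (continuous_const.sub (hu.inner hv))).mul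
      ((CCR.continuous_expVec.comp hu).inner
        (T.continuous.comp (CCR.continuous_expVec.comp hv)))
  · intro x
    -- Unitality is the case `u = 0` of the Weyl relation, since `W(0) = 1`.
    rw [← CCR.weyl_zero, hweyl, map_zero]
  · rintro β ⟨hβ, hβweyl⟩
    funext x
    exact CCR.isNormalEndo_ext (hβ.normal x) (hnormal x) fun u => by rw [hβweyl, hweyl]
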